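/- Let $k$ be a field of characteristic $\neq 2$ and let $n\ge 1$ be an integer. Let $C_n=\langle c\rangle$ be the cyclic group of order $n$, $k[C_n]$ its group Hopf algebra, and let $H_4$ be Sweedler's Hopf algebra over $k$: it has basis $1,g,x,gx$, relations $g^2=1$, $x^2=0$, $xg=-gx$, and $\Delta(g)=g\otimes g$, $\Delta(x)=x\otimes 1+g\otimes x$, $\varepsilon(g)=1$, $\varepsilon(x)=0$, $S(g)=g$, $S(x)=-gx$. Identify $C_2$ with $\{1,g\}\subset H_4$, and let $\mathcal U(C_n,C_2)$ be the set of all maps $t:C_n\to C_2$ with $t(1)=1$. **Crossed systems.** A crossed system of Hopf algebras $(A,H,\triangleright,f)$ consists of coalgebra maps $\triangleright:H\otimes A\to A$ and $f:H\otimes H\to A$ such that, for all $a,b\in A$ and $g,h,l\in H$, $$1\triangleright a=a,\qquad h\triangleright 1=\varepsilon(h)1,\qquad h\triangleright(ab)=(h_{(1)}\triangleright a)(h_{(2)}\triangleright b),\qquad f(h,1)=f(1,h)=\varepsilon(h)1,$$ $$[g_{(1)}\triangleright(h_{(1)}\triangleright a)]\,f(g_{(2)},h_{(2)})=f(g_{(1)},h_{(1)})\,((g_{(2)}h_{(2)})\triangleright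 a),$$ $$(g_{(1)}\triangleright f(h_{(1)},l_{(1)}))\,f(g_{(2)},h_{(2)}l_{(2)})=f(g_{(1)},h_{(1)})\,f(g_{(2)}h_{(2)},l),$$ $$g_{(1)}\otimes(g_{(2)}\triangleright a)=g_{(2)}\otimes(g_{(1)}\triangleright a),\qquad g_{(1)}h_{(1)}\otimes f(g_{(2)},h_{(2)})=g_{(2)}h_{(2)}\otimes f(g_{(1)},h_{(1)}).$$ Its crossed product is the Hopf algebra $A\#_f^{\triangleright}H$ with underlying coalgebra $A\otimes H$, unit $1\#1$ and multiplication $(a\#g)(b\#h)=a(g_{(1)}\triangleright b)f(g_{(2)},h_{(1)})\#g_{(3)}h_{(2)}$. **The classifying objects.** Two crossed systems $(\triangleright,f)$, $(\triangleright',f')$ of $A$ and $H$ are *cohomologous* if there is a unit preserving coalgebra map $r:H\to A$ with $r(h_{(1)})\otimes h_{(2)}=r(h_{(2)})\otimes h_{(1)}$ such that, for all $a\in A$ and $g,h\in H$, $$h\triangleright' a=r(h_{(1)})(h_{(2)}\triangleright a)S_A(r(h_{(3)})),\qquad f'(h,g)=r(h_{(1)})(h_{(2)}\triangleright r(g_{(1)}))f(h_{(3)},g_{(2)})S_A(r(h_{(4)}g_{(3)})).$$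 Let $\mathcal H^2(H,A)$ be the set of crossed systems modulo this relation, and let $\mathrm{Crp}(H,A)$ be the set of Hopf algebra isomorphism types of all crossed products $A\#_f^{\triangleright}H$. **The parameters.** For $t\in\mathcal U(C_n,C_2)$ put $\sigma_t(0)=\sigma_t(1)=0$ and, for $j\ge2$, $\sigma_t(j)=\epsilon_j+\sum_{p=1}^{j-1}\operatorname{ord}t(c^p)$, where $\epsilon_j=1$ if $j$ is even and $\epsilon_j=0$ if $j$ is odd. Let $$\mathcal{CS}(n,k)=\{(t,\lambda)\in\mathcal U(C_n,C_2)\times k^*:\lambda^n=(-1)^{\sigma_t(n)}\}.$$ Say that a crossed system of $H_4$ and $k[C_n]$ is *given by* $(t,\lambda)$ if for all $i,j=1,\dots,n$ $$c^j\triangleright1=1,\quad c^j\triangleright g=g,\quad c^j\triangleright x=(-1)^{\sigma_t(j)}\lambda^jx,\quad c^j\triangleright gx=(-1)^{\sigma_t(j)}\lambda^jgx,$$ $$f(c^i,c^j)=\prod_{p=0}^{i-1}t(c^p)\prod_{q=0}^{j-1}t(c^q)\prod_{r=0}^{i+j-1}t(c^r).$$ **Theorem.** 1. Being cohomologous is an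 equivalence relation on the crossed systems of $H_4$ and $k[C_n]$. Write $(t,\lambda)\approx(t',\lambda')$ if there is $r\in\mathcal U(C_n,C_2)$ such that for all $i,j=1,\dots,n$ $$\prod_{p=0}^{i-1}t(c^p)t(c^{p+j})=r(c^i)r(c^j)r(c^{i+j})\prod_{q=0}^{i-1}t'(c^q)t'(c^{q+j}),$$ $$(-1)^{1+\sigma_t(i)+\operatorname{ord}r(c^i)}\lambda^i=(-1)^{\sigma_{t'}(i)}(\lambda')^i.$$ Then $\approx$ is an equivalence relation on $\mathcal{CS}(n,k)$, and there is a bijection $\mathcal H^2(k[C_n],H_4)\to\mathcal{CS}(n,k)/{\approx}$. For every $(t,\lambda)\in\mathcal{CS}(n,k)$ there is a crossed system given by $(t,\lambda)$, and the bijection sends its class to the class of $(t,\lambda)$. 2. Write $(t,\lambda)\equiv(t',\lambda')$ if there are $\beta\in k^*$, $r\in\mathcal U(C_n,C_2)$ and $s\in\{1,\dots,n\}$ with $\gcd(s,n)=1$ such that for all $i,j=1,\dots,n$ $$\prod_{p=0}^{i-1}t(c^p)t(c^{p+j})=r(c^i)r(c^j)r(c^{i+j})\prod_{q=0}^{is-1}t'(c^q)t'(c^{q+js}),$$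 $$(-1)^{1+\sigma_t(i)+\operatorname{ord}r(c^i)}\lambda^i\beta=(-1)^{\sigma_{t'}(is)}(\lambda')^{is}.$$ Then $\equiv$ is an equivalence relation on $\mathcal{CS}(n,k)$, and there is a bijection $\mathrm{Crp}(k[C_n],H_4)\to\mathcal{CS}(n,k)/{\equiv}$. For every $(t,\lambda)\in\mathcal{CS}(n,k)$ it sends the isomorphism type of the crossed product of a crossed system given by $(t,\lambda)$ to the class of $(t,\lambda)$. -/

import Mathlib

open scoped TensorProduct
open Coalgebra HopfAlgebra WithConv

universe u v w

namespace HopfCrossed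

noncomputable section

section Sweedler

/-- Sweedler's four-dimensional Hopf algebra `H₄` over `k`.  As an algebra it is the generalized
quaternion algebra with parameters `(1, 0, 0)`: it has `k`-basis `1, g, x, g x` (the standard
basis `1, i, j, k` of `QuaternionAlgebra`), and `g ^ 2 = 1`, `x ^ 2 = 0`, `x g = - g x`. -/
def SweedlerH4 (k : Type u) [Field k] : Type u := QuaternionAlgebra k 1 0 0

namespace SweedlerH4

variable (k : Type u) [Field k]

instance : Ring (SweedlerH4 k) := inferInstanceAs (Ring (QuaternionAlgebra k 1 0 0))

instance : Algebra k (SweedlerH4 k) := inferInstanceAs (Algebra k (QuaternionAlgebra k 1 0 0))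

/-- The basis `1, g, x, g x` of `H₄`. -/
def basis : Module.Basis (Fin 4) k (SweedlerH4 k) := QuaternionAlgebra.basisOneIJK 1 0 0

/-- The group-like generator `g` of `H₄`. -/
def g : SweedlerH4 k := (⟨0, 1, 0, 0⟩ : QuaternionAlgebra k 1 0 0)

/-- The skew-primitive generator `x` of `H₄`. -/
def x : SweedlerH4 k := (⟨0, 0, 1, 0⟩ : QuaternionAlgebra k 1 0 0)

/-- The standard generators of the quaternion algebra underlying `H₄`. -/
abbrev quat : QuaternionAlgebra.Basis (QuaternionAlgebra k 1 0 0) (1 : k) 0 0 :=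
  QuaternionAlgebra.Basis.self k

theorem g_mul_g : g k * g k = 1 :=
  (quat k).i_mul_i.trans (by simp; rfl)

theorem x_mul_x : x k * x k = 0 :=
  (quat k).j_mul_j.trans (by simp; rfl)

theorem x_mul_g : x k * g k = -(g k * x k) :=
  ((quat k).j_mul_i.trans
    (by rw [zero_smul, zero_sub]; rfl)).trans (congrArg Neg.neg
      (quat k).i_mul_j.symm)

theorem basis_zero : basis k 0 = 1 := by
  apply (basis k).repr.injective
  rw [Module.Basis.repr_self]
  ext i
  have := congrFun (QuaternionAlgebra.coe_basisOneIJK_repr (1 : k) 0 0 1) i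
  refine Eq.trans ?_ this.symm
  fin_cases i <;> simp

theorem basis_one : basis k 1 = g k := by
  apply (basis k).repr.injective
  rw [Module.Basis.repr_self]
  ext i
  have := congrFun (QuaternionAlgebra.coe_basisOneIJK_repr (1 : k) 0 0 (g k)) i
  refine Eq.trans ?_ this.symm
  fin_cases i <;> simp [g]

theorem basis_two : basis k 2 = x k := by
  apply (basis k).repr.injective
  rw [Module.Basis.repr_self]
  ext i
  have := congrFun (QuaternionAlgebra.coe_basisOneIJK_repr (1 : k) 0 0 (x k)) i
  refine Eq.trans ?_ this.symm
  fin_cases i <;> simp [x]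

theorem basis_three : basis k 3 = g k * x k := by
  have h : g k * x k = (quat k).k :=
    (quat k).i_mul_j
  rw [h]
  apply (basis k).repr.injective
  rw [Module.Basis.repr_self]
  ext i
  have := congrFun (QuaternionAlgebra.coe_basisOneIJK_repr (1 : k) 0 0
    (quat k).k) i
  refine Eq.trans ?_ this.symm
  fin_cases i <;> simp

/-- Algebra maps out of `H₄` are determined by the images of `g` and `x`, which may be any elements
satisfying the defining relations. -/
def lift {B : Type v} [Ring B] [Algebra k B] (a b : B) (ha : a * a = 1) (hb : b * b = 0)
    (hab : b * a = -(a * b)) : SweedlerH4 k →ₐ[k] B :=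
  (QuaternionAlgebra.Basis.liftHom
    { i := a, j := b, k := a * b, i_mul_i := by simpa using ha, j_mul_j := by simpa using hb,
      i_mul_j := rfl, j_mul_i := by simpa using hab } : QuaternionAlgebra k 1 0 0 →ₐ[k] B)

theorem lift_g {B : Type v} [Ring B] [Algebra k B] (a b : B) (ha : a * a = 1) (hb : b * b = 0)
    (hab : b * a = -(a * b)) : lift k a b ha hb hab (g k) = a := by
  refine (QuaternionAlgebra.Basis.liftHom_apply _ _).trans ?_
  simp [g, QuaternionAlgebra.Basis.lift]

theorem lift_x {B : Type v} [Ring B] [Algebra k B] (a b : B) (ha : a * a = 1) (hb : b * b = 0)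
    (hab : b * a = -(a * b)) : lift k a b ha hb hab (x k) = b := by
  refine (QuaternionAlgebra.Basis.liftHom_apply _ _).trans ?_
  simp [x, QuaternionAlgebra.Basis.lift]

theorem algHom_ext {B : Type v} [Ring B] [Algebra k B] {F G : SweedlerH4 k →ₐ[k] B}
    (hg : F (g k) = G (g k)) (hx : F (x k) = G (x k)) : F = G :=
  QuaternionAlgebra.hom_ext (c₁ := (1 : k)) (c₂ := 0) (c₃ := 0) hg hx

/-- The comultiplication of `H₄`: the algebra map with `Δ g = g ⊗ g`, `Δ x = x ⊗ 1 + g ⊗ x`. -/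
def comulHom : SweedlerH4 k →ₐ[k] SweedlerH4 k ⊗[k] SweedlerH4 k :=
  lift k (g k ⊗ₜ g k) (x k ⊗ₜ 1 + g k ⊗ₜ x k)
    (by simp [g_mul_g, Algebra.TensorProduct.one_def])
    (by simp [mul_add, add_mul, g_mul_g, x_mul_x, x_mul_g, TensorProduct.neg_tmul])
    (by simp [mul_add, add_mul, g_mul_g, x_mul_g, TensorProduct.neg_tmul, TensorProduct.tmul_neg,
      add_comm])

/-- The counit of `H₄`: the algebra map with `ε g = 1`, `ε x = 0`. -/
def counitHom : SweedlerH4 k →ₐ[k] k := lift k 1 0 (by simp) (by simp) (by simp)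

/-- The antipode of `H₄`: the linear map with `S 1 = 1`, `S g = g`, `S x = - g x`, `S (g x) = x`. -/
def antipodeMap : SweedlerH4 k →ₗ[k] SweedlerH4 k :=
  (basis k).constr k ![1, g k, -(g k * x k), x k]

theorem comulHom_g : comulHom k (g k) = g k ⊗ₜ g k := lift_g ..

theorem comulHom_x : comulHom k (x k) = x k ⊗ₜ 1 + g k ⊗ₜ x k := lift_x ..

theorem counitHom_g : counitHom k (g k) = 1 := lift_g ..

theorem counitHom_x : counitHom k (x k) = 0 := lift_x ..

instance : Bialgebra k (SweedlerH4 k) :=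
  Bialgebra.ofAlgHom (comulHom k) (counitHom k)
    (algHom_ext k (by simp [comulHom_g])
      (by simp [comulHom_x, comulHom_g, TensorProduct.add_tmul, TensorProduct.tmul_add,
        Algebra.TensorProduct.one_def, add_assoc]))
    (algHom_ext k (by simp [comulHom_g, counitHom_g])
      (by simp [comulHom_x, counitHom_g, counitHom_x]))
    (algHom_ext k (by simp [comulHom_g, counitHom_g])
      (by simp [comulHom_x, counitHom_x]))

theorem comul_g : comul (R := k) (g k) = g k ⊗ₜ g k := comulHom_g k

theorem comul_x : comul (R := k) (x k) = x k ⊗ₜ 1 + g k ⊗ₜ x k := comulHom_x k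

theorem counit_g : counit (R := k) (g k) = 1 := counitHom_g k

theorem counit_x : counit (R := k) (x k) = 0 := counitHom_x k

theorem antipodeMap_one : antipodeMap k 1 = 1 := by
  rw [← basis_zero, antipodeMap, Module.Basis.constr_basis, basis_zero]; rfl

theorem antipodeMap_g : antipodeMap k (g k) = g k := by
  rw [← basis_one, antipodeMap, Module.Basis.constr_basis, basis_one]; rfl

theorem antipodeMap_x : antipodeMap k (x k) = -(g k * x k) := by
  conv_lhs => rw [← basis_two, antipodeMap, Module.Basis.constr_basis]
  rfl

theorem antipodeMap_gx : antipodeMap k (g k * x k) = x k := by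
  rw [← basis_three, antipodeMap, Module.Basis.constr_basis]; rfl

theorem gg_mul (a : SweedlerH4 k) : g k * (g k * a) = a := by rw [← mul_assoc, g_mul_g, one_mul]

instance : HopfAlgebra k (SweedlerH4 k) where
  antipode := antipodeMap k
  mul_antipode_rTensor_comul := by
    refine (basis k).ext fun i => ?_
    fin_cases i
    · simp [basis_zero, Algebra.TensorProduct.one_def, antipodeMap_one]
    · simp [basis_one, comul_g, counit_g, antipodeMap_g, g_mul_g]
    · simp [basis_two, comul_x, counit_x, antipodeMap_g, antipodeMap_x]
    · simp [basis_three, comul_x, counit_x, comul_g, antipodeMap_gx, antipodeMap_one, mul_add,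
        g_mul_g, x_mul_g]
  mul_antipode_lTensor_comul := by
    refine (basis k).ext fun i => ?_
    fin_cases i
    · simp [basis_zero, Algebra.TensorProduct.one_def, antipodeMap_one]
    · simp [basis_one, comul_g, counit_g, antipodeMap_g, g_mul_g]
    · simp [basis_two, comul_x, counit_x, antipodeMap_one, antipodeMap_x, gg_mul]
    · simp [basis_three, comul_x, counit_x, comul_g, antipodeMap_gx, antipodeMap_g, mul_add,
        g_mul_g, x_mul_g, mul_assoc, gg_mul]

end SweedlerH4
end Sweedler

section CrossedSystems

/-- For a linear map `φ : H ⊗ A → A` and `a : A`, the linear map `h ↦ φ (h ⊗ a)`. -/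
def slice {k : Type u} {A : Type v} {H : Type w} [Field k] [AddCommGroup A] [Module k A]
    [AddCommGroup H] [Module k H] (φ : H ⊗[k] A →ₗ[k] A) (a : A) : H →ₗ[k] A :=
  φ ∘ₗ (TensorProduct.mk k H A).flip a

/-- For a coalgebra `H`, the linear map `H ⊗ H → H`, `g ⊗ h ↦ ε(h) g`. -/
def killRight (k : Type u) (H : Type w) [Field k] [AddCommGroup H] [Module k H]
    [Coalgebra k H] : H ⊗[k] H →ₗ[k] H :=
  (TensorProduct.rid k H).toLinearMap ∘ₗ (counit (R := k) (A := H)).lTensor H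

/-- A crossed system of Hopf algebras `(A, H, ▷, f)`: coalgebra maps `▷ : H ⊗ A → A` and
`f : H ⊗ H → A` such that `▷` is a weak action of `H` on `A` and the normalization, twisted module,
cocycle and compatibility conditions hold.  In a field whose equation is between elements of
`WithConv (C →ₗ[k] A)`, the product is Mathlib's convolution product
`(F * G) z = F z₍₁₎ * G z₍₂₎`; the tensor products `H ⊗ H` and `H ⊗ (H ⊗ H)` carry the tensor
product coalgebra structure. -/
structure CrossedSystem (k : Type u) (A : Type v) (H : Type w) [Field k]
    [Ring A] [HopfAlgebra k A] [Ring H] [HopfAlgebra k H] where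
  /-- The action `h ⊗ a ↦ h ▷ a`, a morphism of coalgebras. -/
  act : H ⊗[k] A →ₗc[k] A
  /-- The cocycle `h ⊗ h' ↦ f (h, h')`, a morphism of coalgebras. -/
  coc : H ⊗[k] H →ₗc[k] A
  /-- `1 ▷ a = a`. -/
  one_act : ∀ a : A, act (1 ⊗ₜ a) = a
  /-- `h ▷ 1 = ε(h) 1`. -/
  act_one : ∀ h : H, act (h ⊗ₜ 1) = algebraMap k A (counit h)
  /-- `h ▷ (a b) = (h₍₁₎ ▷ a) (h₍₂₎ ▷ b)`. -/
  act_mul : ∀ a b : A,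
    toConv (slice act.toLinearMap (a * b)) =
      toConv (slice act.toLinearMap a) * toConv (slice act.toLinearMap b)
  /-- `f (h, 1) = ε(h) 1`. -/
  coc_one : ∀ h : H, coc (h ⊗ₜ 1) = algebraMap k A (counit h)
  /-- `f (1, h) = ε(h) 1`. -/
  one_coc : ∀ h : H, coc (1 ⊗ₜ h) = algebraMap k A (counit h)
  /-- `(g₍₁₎ ▷ (h₍₁₎ ▷ a)) f (g₍₂₎, h₍₂₎) = f (g₍₁₎, h₍₁₎) ((g₍₂₎ h₍₂₎) ▷ a)`. -/
  twisted : ∀ a : A,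
    toConv (act.toLinearMap ∘ₗ (slice act.toLinearMap a).lTensor H) *
        toConv coc.toLinearMap =
      toConv coc.toLinearMap *
        toConv (slice act.toLinearMap a ∘ₗ LinearMap.mul' k H)
  /-- `(g₍₁₎ ▷ f (h₍₁₎, l₍₁₎)) f (g₍₂₎, h₍₂₎ l₍₂₎) = f (g₍₁₎, h₍₁₎) f (g₍₂₎ h₍₂₎, l)`, as maps of
  `g ⊗ (h ⊗ l)`; the first factor on the right is `g ⊗ (h ⊗ l) ↦ f (g, h) ε(l)`. -/
  cocycle :
    toConv (act.toLinearMap ∘ₗ coc.toLinearMap.lTensor H) *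
        toConv (coc.toLinearMap ∘ₗ (LinearMap.mul' k H).lTensor H) =
      toConv (coc.toLinearMap ∘ₗ (killRight k H).lTensor H) *
        toConv (coc.toLinearMap ∘ₗ (LinearMap.mul' k H).rTensor H ∘ₗ
          (TensorProduct.assoc k H H H).symm.toLinearMap)
  /-- `g₍₁₎ ⊗ (g₍₂₎ ▷ a) = g₍₂₎ ⊗ (g₍₁₎ ▷ a)`. -/
  act_cocentral : ∀ (g : H) (a : A),
    (slice act.toLinearMap a).lTensor H (comul g) =
      (slice act.toLinearMap a).lTensor H
        (TensorProduct.comm k H H (comul g))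
  /-- `g₍₁₎ h₍₁₎ ⊗ f (g₍₂₎, h₍₂₎) = g₍₂₎ h₍₂₎ ⊗ f (g₍₁₎, h₍₁₎)`. -/
  coc_cocentral : ∀ z : H ⊗[k] H,
    TensorProduct.map (LinearMap.mul' k H) coc.toLinearMap (comul z) =
      TensorProduct.map (LinearMap.mul' k H) coc.toLinearMap
        (TensorProduct.comm k (H ⊗[k] H) (H ⊗[k] H) (comul z))

variable {k : Type u} {A : Type v} {H : Type w} [Field k]
    [Ring A] [HopfAlgebra k A] [Ring H] [HopfAlgebra k H]

namespace CrossedSystem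

/-- Two crossed systems `S = (▷, f)` and `S' = (▷', f')` are cohomologous if there is a unitary
cocentral map `r : H → A` (a unit preserving coalgebra map with
`r(h₍₁₎) ⊗ h₍₂₎ = r(h₍₂₎) ⊗ h₍₁₎`) such that
`h ▷' a = r(h₍₁₎) (h₍₂₎ ▷ a) S(r(h₍₃₎))` and
`f'(h, g) = r(h₍₁₎) (h₍₂₎ ▷ r(g₍₁₎)) f(h₍₃₎, g₍₂₎) S(r(h₍₄₎ g₍₃₎))`, where products of linear maps
are convolution products. -/
def Cohomologous (S S' : CrossedSystem k A H) : Prop :=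
  ∃ r : H →ₗc[k] A, r 1 = 1 ∧
    (∀ h : H, r.toLinearMap.rTensor H (comul h) =
      r.toLinearMap.rTensor H (TensorProduct.comm k H H (comul h))) ∧
    (∀ a : A, toConv (slice S'.act.toLinearMap a) =
      toConv r.toLinearMap * toConv (slice S.act.toLinearMap a) *
        toConv (antipode k ∘ₗ r.toLinearMap)) ∧
    toConv S'.coc.toLinearMap =
      toConv (r.toLinearMap ∘ₗ killRight k H) *
        toConv (S.act.toLinearMap ∘ₗ r.toLinearMap.lTensor H) *
        toConv S.coc.toLinearMap *
        toConv (antipode k ∘ₗ r.toLinearMap ∘ₗ LinearMap.mul' k H)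

/-- The linear map `g ⊗ h ↦ a (g₍₁₎ ▷ b) f (g₍₂₎, h)`, bilinear in `a` and `b`. -/
def mulCore (S : CrossedSystem k A H) : A →ₗ[k] A →ₗ[k] (H ⊗[k] H →ₗ[k] A) :=
  LinearMap.mk₂ k
    (fun a b => LinearMap.mulLeft k a ∘ₗ
      (toConv (slice S.act.toLinearMap b ∘ₗ killRight k H) * toConv S.coc.toLinearMap).ofConv)
    (fun a a' b => by ext; simp [add_mul])
    (fun c a b => by ext; simp)
    (fun a b b' => by ext; simp [slice, LinearMap.comp_add, LinearMap.add_comp,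
      TensorProduct.map_add_left, mul_add])
    (fun c a b => by ext; simp [slice, LinearMap.comp_smul, LinearMap.smul_comp])

/-- The multiplication of the crossed product on the vector space `A ⊗ H`:
`(a # g) (b # h) = a (g₍₁₎ ▷ b) f (g₍₂₎, h₍₁₎) # g₍₃₎ h₍₂₎`. -/
def crossedMul (S : CrossedSystem k A H) : A ⊗[k] H →ₗ[k] A ⊗[k] H →ₗ[k] A ⊗[k] H :=
  TensorProduct.lift (LinearMap.mk₂ k
    (fun a g => TensorProduct.lift (LinearMap.mk₂ k
      (fun b h => TensorProduct.map (S.mulCore a b) (LinearMap.mul' k H) (comul (g ⊗ₜ[k] h)))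
      (fun b b' h => by simp [TensorProduct.map_add_left])
      (fun c b h => by simp [TensorProduct.map_smul_left])
      (fun b h h' => by simp [TensorProduct.tmul_add])
      (fun c b h => by simp)))
    (fun a a' g => by
      refine TensorProduct.ext' fun b h => ?_
      simp [TensorProduct.map_add_left])
    (fun c a g => by
      refine TensorProduct.ext' fun b h => ?_
      simp [TensorProduct.map_smul_left])
    (fun a g g' => by
      refine TensorProduct.ext' fun b h => ?_
      simp [TensorProduct.add_tmul])
    (fun c a g => by
      refine TensorProduct.ext' fun b h => ?_
      simp [← TensorProduct.smul_tmul']))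

end CrossedSystem

variable (k A H) in
/-- The classifying object `ℋ²(H, A)`: crossed systems modulo the relation of being
cohomologous. -/
def H2 : Type (max v w) := Quot (CrossedSystem.Cohomologous (k := k) (A := A) (H := H))

end CrossedSystems

section GroupAlgebra

variable {k : Type u} {A : Type v} {G : Type w} [Field k] [Ring A] [HopfAlgebra k A] [Group G]

namespace CrossedSystem

variable (S : CrossedSystem k A (MonoidAlgebra k G))

/-- `g ▷ a` for a group element `g`. -/
def ga (g : G) (a : A) : A := S.act (MonoidAlgebra.single g 1 ⊗ₜ a)

/-- `f (g, h)` for group elements `g`, `h`. -/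
def gf (g h : G) : A := S.coc (MonoidAlgebra.single g 1 ⊗ₜ MonoidAlgebra.single h 1)

theorem ga_mul (g : G) (a b : A) : S.ga g (a * b) = S.ga g a * S.ga g b := by
  have h := congrArg (fun F => F (MonoidAlgebra.single g (1 : k))) (S.act_mul a b)
  simpa [slice, ga] using h

theorem ga_ga (g h : G) (a : A) : S.ga g (S.ga h a) * S.gf g h = S.gf g h * S.ga (g * h) a := by
  have h := congrArg
    (fun F => F (MonoidAlgebra.single g (1 : k) ⊗ₜ MonoidAlgebra.single h (1 : k))) (S.twisted a)
  simpa [slice, ga, gf] using h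

theorem ga_gf (g h l : G) : S.ga g (S.gf h l) * S.gf g (h * l) = S.gf g h * S.gf (g * h) l := by
  have h := congrArg
    (fun F => F (MonoidAlgebra.single g (1 : k) ⊗ₜ (MonoidAlgebra.single h (1 : k) ⊗ₜ
      MonoidAlgebra.single l (1 : k)))) S.cocycle
  simpa [killRight, ga, gf] using h

theorem one_ga (a : A) : S.ga 1 a = a := S.one_act a

theorem ga_one (g : G) : S.ga g 1 = 1 := by
  simpa [ga] using S.act_one (MonoidAlgebra.single g 1)

theorem gf_one (g : G) : S.gf g 1 = 1 := by
  simpa [gf, MonoidAlgebra.one_def] using S.coc_one (MonoidAlgebra.single g 1)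

theorem one_gf (g : G) : S.gf 1 g = 1 := by
  simpa [gf, MonoidAlgebra.one_def] using S.one_coc (MonoidAlgebra.single g 1)

theorem crossedMul_single (a b : A) (g h : G) :
    S.crossedMul (a ⊗ₜ MonoidAlgebra.single g 1) (b ⊗ₜ MonoidAlgebra.single h 1) =
      (a * (S.ga g b * S.gf g h)) ⊗ₜ MonoidAlgebra.single (g * h) 1 := by
  simp [crossedMul, mulCore, killRight, slice, ga, gf]


end CrossedSystem

/-- The vector space `A ⊗ H` underlying the crossed product `A #_f^▷ H` of the crossed system
`S = (▷, f)`. -/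
def CrossedProduct {k : Type u} {A : Type v} {H : Type w} [Field k] [Ring A] [HopfAlgebra k A]
    [Ring H] [HopfAlgebra k H] (_S : CrossedSystem k A H) : Type (max v w) := A ⊗[k] H

namespace CrossedProduct

variable (S : CrossedSystem k A (MonoidAlgebra k G))

instance : AddCommGroup (CrossedProduct S) :=
  inferInstanceAs (AddCommGroup (A ⊗[k] MonoidAlgebra k G))

instance : Module k (CrossedProduct S) :=
  inferInstanceAs (Module k (A ⊗[k] MonoidAlgebra k G))

variable {S} in
/-- The element `a # g` of the crossed product, for `a : A` and a group element `g`. -/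
def el (a : A) (g : G) : CrossedProduct S :=
  (a ⊗ₜ[k] MonoidAlgebra.single g 1 : A ⊗[k] MonoidAlgebra k G)

/-- `el` as a linear map. -/
def elₗ (g : G) : A →ₗ[k] CrossedProduct S :=
  (TensorProduct.mk k A (MonoidAlgebra k G)).flip (MonoidAlgebra.single g 1)

/-- The multiplication of the crossed product. -/
def mulₗ : CrossedProduct S →ₗ[k] CrossedProduct S →ₗ[k] CrossedProduct S := S.crossedMul

theorem mulₗ_el (a b : A) (g h : G) :
    mulₗ S (el a g) (el b h) = el (a * (S.ga g b * S.gf g h)) (g * h) :=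
  S.crossedMul_single a b g h

variable {S} in
theorem induction {p : CrossedProduct S → Prop} (z : CrossedProduct S) (h0 : p 0)
    (hadd : ∀ y z, p y → p z → p (y + z)) (hel : ∀ a g, p (el a g)) : p z := by
  refine TensorProduct.induction_on (motive := p) z h0 (fun a h => ?_) hadd
  induction h using MonoidAlgebra.induction_linear with
  | zero => rw [TensorProduct.tmul_zero]; exact h0
  | add f g hf hg => rw [TensorProduct.tmul_add]; exact hadd _ _ hf hg
  | single g r =>
    have : a ⊗ₜ[k] MonoidAlgebra.single g r = (r • a) ⊗ₜ[k] MonoidAlgebra.single g 1 := by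
      rw [TensorProduct.smul_tmul, MonoidAlgebra.smul_single]; simp
    rw [this]; exact hel _ _

theorem el_one_mul (z : CrossedProduct S) : mulₗ S (el 1 1) z = z := by
  refine induction (p := fun z => mulₗ S (el 1 1) z = z) z (by simp)
    (fun y z hy hz => by simp [hy, hz]) fun a g => ?_
  simp [mulₗ_el, S.one_ga, S.one_gf]

theorem mul_el_one (z : CrossedProduct S) : mulₗ S z (el 1 1) = z := by
  refine induction (p := fun z => mulₗ S z (el 1 1) = z) z (by simp)
    (fun y z hy hz => by simp [hy, hz]) fun a g => ?_
  simp [mulₗ_el, S.ga_one, S.gf_one]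

theorem mulₗ_assoc (x y z : CrossedProduct S) :
    mulₗ S (mulₗ S x y) z = mulₗ S x (mulₗ S y z) := by
  refine induction (p := fun x => mulₗ S (mulₗ S x y) z = mulₗ S x (mulₗ S y z)) x (by simp)
    (fun u v hu hv => by simp [hu, hv]) fun a g => ?_
  refine induction (p := fun y => mulₗ S (mulₗ S (el a g) y) z = mulₗ S (el a g) (mulₗ S y z)) y
    (by simp) (fun u v hu hv => by simp [hu, hv]) fun b h => ?_
  refine induction (p := fun z => mulₗ S (mulₗ S (el a g) (el b h)) z =
    mulₗ S (el a g) (mulₗ S (el b h) z)) z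
    (by simp) (fun u v hu hv => by simp [hu, hv]) fun c l => ?_
  simp only [mulₗ_el, S.ga_mul, mul_assoc, S.ga_gf]
  rw [← mul_assoc (S.ga g (S.ga h c)), S.ga_ga]
  simp only [mul_assoc]

/-- The crossed product with the multiplication
`(a # g) (b # h) = a (g₍₁₎ ▷ b) f (g₍₂₎, h₍₁₎) # g₍₃₎ h₍₂₎` and the unit `1 # 1` is a ring. -/
instance : Ring (CrossedProduct S) :=
  { (inferInstance : AddCommGroup (CrossedProduct S)) with
    mul := fun y z => mulₗ S y z
    one := el 1 1
    zero_mul := fun z => by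
      change mulₗ S 0 z = 0
      simp
    mul_zero := fun z => by
      change mulₗ S z 0 = 0
      simp
    left_distrib := fun x y z => map_add (mulₗ S x) y z
    right_distrib := fun x y z => LinearMap.map_add₂ (mulₗ S) x y z
    one_mul := el_one_mul S
    mul_one := mul_el_one S
    mul_assoc := mulₗ_assoc S }

theorem mul_def (y z : CrossedProduct S) : y * z = mulₗ S y z := rfl

variable {S} in
theorem el_mul_el (a b : A) (g h : G) :
    (el a g * el b h : CrossedProduct S) = el (a * (S.ga g b * S.gf g h)) (g * h) :=
  mulₗ_el S a b g h

theorem one_def : (1 : CrossedProduct S) = el 1 1 := rfl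

instance : Algebra k (CrossedProduct S) :=
  Algebra.ofModule (fun r y z => LinearMap.map_smul₂ (mulₗ S) r y z)
    (fun r y z => map_smul (mulₗ S y) r z)

/-- The coalgebra structure of the crossed product is that of the tensor product `A ⊗ H`. -/
instance : Coalgebra k (CrossedProduct S) :=
  inferInstanceAs (Coalgebra k (A ⊗[k] MonoidAlgebra k G))

/-- The linear map `a ⊗ b ↦ (a # g) ⊗ (b # g)`. -/
def diag (g : G) : A ⊗[k] A →ₗ[k] CrossedProduct S ⊗[k] CrossedProduct S :=
  TensorProduct.map (elₗ S g) (elₗ S g)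

variable {S} in
theorem diag_tmul (g : G) (a b : A) : diag S g (a ⊗ₜ b) = el a g ⊗ₜ el b g := rfl

variable {S} in
theorem comul_el (a : A) (g : G) :
    comul (R := k) (el a g : CrossedProduct S) = diag S g (comul a) := by
  refine (TensorProduct.comul_tmul (R := k) (S := k) a (MonoidAlgebra.single g (1 : k))).trans ?_
  have : comul (R := k) (MonoidAlgebra.single g (1 : k)) =
      MonoidAlgebra.single g (1 : k) ⊗ₜ MonoidAlgebra.single g (1 : k) := by simp
  rw [this]
  induction comul (R := k) a using TensorProduct.induction_on with
  | zero => rw [TensorProduct.zero_tmul, map_zero, map_zero]; rfl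
  | tmul b c => rfl
  | add y z hy hz => rw [TensorProduct.add_tmul, map_add, map_add, hy, hz]; rfl

variable {S} in
theorem counit_el (a : A) (g : G) :
    counit (R := k) (el a g : CrossedProduct S) = counit a := by
  refine (TensorProduct.counit_tmul (R := k) (S := k) a (MonoidAlgebra.single g (1 : k))).trans ?_
  simp

theorem comul_gf (g h : G) : comul (R := k) (S.gf g h) = S.gf g h ⊗ₜ S.gf g h := by
  rw [CrossedSystem.gf, ← CoalgHomClass.map_comp_comul_apply]
  simp

theorem counit_gf (g h : G) : counit (R := k) (S.gf g h) = 1 := by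
  simp [CrossedSystem.gf]

theorem isGroupLikeElem_gf (g h : G) : IsGroupLikeElem k (S.gf g h) :=
  ⟨counit_gf S g h, comul_gf S g h⟩

/-- The linear map `a ↦ g ▷ a`. -/
def gaₗ (g : G) : A →ₗ[k] A :=
  S.act.toLinearMap ∘ₗ TensorProduct.mk k (MonoidAlgebra k G) A (MonoidAlgebra.single g 1)

theorem comul_ga (g : G) (a : A) : comul (R := k) (S.ga g a) =
    TensorProduct.map (gaₗ S g) (gaₗ S g) (comul a) := by
  rw [CrossedSystem.ga, ← CoalgHomClass.map_comp_comul_apply]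
  have : comul (R := k) (MonoidAlgebra.single g (1 : k)) =
      MonoidAlgebra.single g (1 : k) ⊗ₜ MonoidAlgebra.single g (1 : k) := by simp
  rw [TensorProduct.comul_tmul, this]
  induction comul (R := k) a using TensorProduct.induction_on with
  | zero => simp
  | tmul b c => rfl
  | add y z hy hz => rw [TensorProduct.tmul_add, map_add, map_add, map_add, hy, hz]

theorem counit_ga (g : G) (a : A) : counit (R := k) (S.ga g a) = counit a := by
  simp [CrossedSystem.ga]

theorem diag_mul (g h : G) (u v : A ⊗[k] A) : diag S g u * diag S h v =
    diag S (g * h) (u * (TensorProduct.map (gaₗ S g) (gaₗ S g) v *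
      (S.gf g h ⊗ₜ S.gf g h))) := by
  induction u using TensorProduct.induction_on with
  | zero => simp
  | add y z hy hz => simp only [map_add, add_mul, hy, hz]
  | tmul a b =>
    induction v using TensorProduct.induction_on with
    | zero => simp
    | add y z hy hz => simp only [map_add, add_mul, mul_add, hy, hz]
    | tmul c d =>
      rw [diag_tmul, diag_tmul, Algebra.TensorProduct.tmul_mul_tmul, el_mul_el, el_mul_el,
        TensorProduct.map_tmul, Algebra.TensorProduct.tmul_mul_tmul,
        Algebra.TensorProduct.tmul_mul_tmul, diag_tmul]
      rfl

instance : Bialgebra k (CrossedProduct S) :=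
  Bialgebra.mk' k (CrossedProduct S)
    (by rw [one_def, counit_el, Bialgebra.counit_one])
    (fun {y z} => by
      refine induction (p := fun y => counit (R := k) (y * z) = counit y * counit z) y (by simp)
        (fun u v hu hv => by simp only [add_mul, map_add, hu, hv]) fun a g => ?_
      refine induction (p := fun z => counit (R := k) (el a g * z) = counit (el a g) * counit z) z
        (by simp) (fun u v hu hv => by simp only [mul_add, map_add, hu, hv]) fun b h => ?_
      simp [el_mul_el, counit_el, counit_ga, counit_gf])
    (by rw [one_def, comul_el, Bialgebra.comul_one]; rfl)
    (fun {y z} => by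
      refine induction (p := fun y => comul (R := k) (y * z) = comul y * comul z) y (by simp)
        (fun u v hu hv => by simp only [add_mul, map_add, hu, hv]) fun a g => ?_
      refine induction (p := fun z => comul (R := k) (el a g * z) = comul (el a g) * comul z) z
        (by simp) (fun u v hu hv => by simp only [mul_add, map_add, hu, hv]) fun b h => ?_
      rw [el_mul_el, comul_el, comul_el, comul_el, diag_mul, Bialgebra.comul_mul,
        Bialgebra.comul_mul, comul_ga, comul_gf])

/-- The linear map `h ↦ S_A (f (S h₍₂₎, h₍₃₎)) # S h₍₁₎`. -/
def antipodeAux : MonoidAlgebra k G →ₗ[k] CrossedProduct S :=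
  (TensorProduct.comm k (MonoidAlgebra k G) A).toLinearMap ∘ₗ
    TensorProduct.map (antipode k)
      (antipode k ∘ₗ S.coc.toLinearMap ∘ₗ (antipode k).rTensor (MonoidAlgebra k G) ∘ₗ comul) ∘ₗ
    comul

/-- The antipode `a # h ↦ (S_A (f (S h₍₂₎, h₍₃₎)) # S h₍₁₎) (S_A a # 1)` of the crossed product. -/
def antipodeMap : CrossedProduct S →ₗ[k] CrossedProduct S :=
  TensorProduct.lift ((mulₗ S).compl₁₂ (antipodeAux S) (elₗ S 1 ∘ₗ antipode k)).flip

variable {S} in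
theorem antipodeMap_el (a : A) (g : G) : antipodeMap S (el a g) =
    el (antipode k (S.gf g⁻¹ g)) g⁻¹ * el (antipode k a) 1 := by
  have : antipodeAux S (MonoidAlgebra.single g 1) = el (antipode k (S.gf g⁻¹ g)) g⁻¹ := by
    have e : ((TensorProduct.comm k (MonoidAlgebra k G) A).toLinearMap ∘ₗ
        TensorProduct.map (antipode k) (antipode k ∘ₗ S.coc.toLinearMap ∘ₗ
          (antipode k).rTensor (MonoidAlgebra k G) ∘ₗ comul) ∘ₗ comul :
          MonoidAlgebra k G →ₗ[k] A ⊗[k] MonoidAlgebra k G) (MonoidAlgebra.single g 1) =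
        antipode k (S.gf g⁻¹ g) ⊗ₜ MonoidAlgebra.single g⁻¹ 1 := by
      simp [CrossedSystem.gf]
    exact e
  rw [mul_def, ← this]
  rfl

theorem algebraMap_eq (r : k) : algebraMap k (CrossedProduct S) r = el (algebraMap k A r) 1 := by
  rw [Algebra.algebraMap_eq_smul_one, Algebra.algebraMap_eq_smul_one, one_def]
  exact ((elₗ S 1).map_smul r 1).symm

theorem el_one_mul_el_one (a b : A) : (el a 1 * el b 1 : CrossedProduct S) = el (a * b) 1 := by
  rw [el_mul_el, S.one_ga, S.one_gf]; simp

theorem el_eq (a : A) (g : G) : (el a g : CrossedProduct S) = el a 1 * el 1 g := by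
  rw [el_mul_el, S.one_ga, S.one_gf]; simp

theorem ga_gf_inv (g : G) : S.ga g (S.gf g⁻¹ g) = S.gf g g⁻¹ := by
  have := S.ga_gf g g⁻¹ g
  simpa [S.gf_one, S.one_gf] using this

instance : HopfAlgebra k (CrossedProduct S) where
  antipode := antipodeMap S
  mul_antipode_rTensor_comul := by
    ext z
    refine induction (p := fun z =>
      (LinearMap.mul' k _ ∘ₗ (antipodeMap S).rTensor _ ∘ₗ comul) z =
      (Algebra.linearMap k (CrossedProduct S) ∘ₗ counit) z) z (by simp)
      (fun u v hu hv => by simp only [map_add, hu, hv]) fun a g => ?_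
    have key (u : A ⊗[k] A) : LinearMap.mul' k _ ((antipodeMap S).rTensor _ (diag S g u)) =
        el (antipode k (S.gf g⁻¹ g)) g⁻¹ *
          (el (LinearMap.mul' k A ((antipode k).rTensor A u)) 1 * el 1 g) := by
      induction u using TensorProduct.induction_on with
      | zero =>
        have : (el (0 : A) 1 : CrossedProduct S) = 0 := (elₗ S 1).map_zero
        simp [this]
      | tmul b c =>
        rw [diag_tmul, LinearMap.rTensor_tmul, LinearMap.mul'_apply, antipodeMap_el,
          el_eq S c g, mul_assoc, ← mul_assoc (el _ 1) (el c 1), el_one_mul_el_one]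
        simp
      | add y z hy hz =>
        have (b c : A) : (el (b + c) 1 : CrossedProduct S) = el b 1 + el c 1 :=
          (elₗ S 1).map_add b c
        simp only [map_add, hy, hz, this, add_mul, mul_add]
    rw [LinearMap.comp_apply, LinearMap.comp_apply, comul_el, key,
      mul_antipode_rTensor_comul_apply, ← algebraMap_eq, LinearMap.comp_apply, counit_el,
      Algebra.linearMap_apply, ← mul_assoc, ← Algebra.commutes, mul_assoc, el_mul_el, S.ga_one,
      one_mul, (isGroupLikeElem_gf S _ _).antipode_mul_cancel, inv_mul_cancel, ← one_def, mul_one]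
  mul_antipode_lTensor_comul := by
    ext z
    refine induction (p := fun z =>
      (LinearMap.mul' k _ ∘ₗ (antipodeMap S).lTensor _ ∘ₗ comul) z =
      (Algebra.linearMap k (CrossedProduct S) ∘ₗ counit) z) z (by simp)
      (fun u v hu hv => by simp only [map_add, hu, hv]) fun a g => ?_
    have h1 : (el 1 g * el (antipode k (S.gf g⁻¹ g)) g⁻¹ : CrossedProduct S) = 1 := by
      rw [el_mul_el, one_mul, ← ga_gf_inv, ← S.ga_mul,
        (isGroupLikeElem_gf S _ _).antipode_mul_cancel, S.ga_one, mul_inv_cancel, ← one_def]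
    have key (u : A ⊗[k] A) : LinearMap.mul' k _ ((antipodeMap S).lTensor _ (diag S g u)) =
          el (LinearMap.mul' k A ((antipode k).lTensor A u)) 1 := by
      induction u using TensorProduct.induction_on with
      | zero =>
        have : (el (0 : A) 1 : CrossedProduct S) = 0 := (elₗ S 1).map_zero
        simp [this]
      | tmul b c =>
        rw [diag_tmul, LinearMap.lTensor_tmul, LinearMap.mul'_apply, antipodeMap_el, el_eq S b,
          mul_assoc, ← mul_assoc (el 1 g), h1, one_mul, el_one_mul_el_one]
        simp
      | add y z hy hz =>
        have (b c : A) : (el (b + c) 1 : CrossedProduct S) = el b 1 + el c 1 :=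
          (elₗ S 1).map_add b c
        simp only [map_add, hy, hz, this]
    rw [LinearMap.comp_apply, LinearMap.comp_apply, comul_el, key,
      mul_antipode_lTensor_comul_apply, ← algebraMap_eq, LinearMap.comp_apply, counit_el,
      Algebra.linearMap_apply]

end CrossedProduct

variable (k A G) in
/-- Two crossed systems are identified if their crossed products are isomorphic Hopf algebras
(isomorphisms of bialgebras between Hopf algebras commute with the antipodes). -/
def crossedProductIso : Setoid (CrossedSystem k A (MonoidAlgebra k G)) where
  r S S' := Nonempty (CrossedProduct S ≃ₐc[k] CrossedProduct S')
  iseqv :=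
    { refl := fun S => ⟨BialgEquiv.refl k (CrossedProduct S)⟩
      symm := fun ⟨e⟩ => ⟨e.symm⟩
      trans := fun ⟨e⟩ ⟨e'⟩ => ⟨e.trans e'⟩ }

variable (k A G) in
/-- The set `Crp(k[G], A)` of Hopf algebra isomorphism types of the crossed products of `A` with
`k[G]` associated to all crossed systems. -/
def Crp : Type (max u v w) := Quotient (crossedProductIso k A G)

end GroupAlgebra

section Parameters

/-- The cyclic group `C_n`, written multiplicatively. -/
abbrev Cyc (n : ℕ) : Type := Multiplicative (ZMod n)

/-- The generator `c` of `C_n`. -/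
def gen (n : ℕ) : Cyc n := Multiplicative.ofAdd 1

/-- The set `𝒰(C_n, C_2)` of unitary maps: arbitrary functions with `1 ↦ 1`. -/
def UnitaryMap (n : ℕ) : Type := {t : Cyc n → Cyc 2 // t 1 = 1}

instance (n : ℕ) : CoeFun (UnitaryMap n) fun _ => Cyc n → Cyc 2 := ⟨Subtype.val⟩

/-- `σ_t(0) = σ_t(1) = 0`, and for `j ≥ 2` the number `σ_t(j)` is
`ord t(c) + ⋯ + ord t(c^(j-1))`, increased by `1` if `j` is even. -/
def sigma {n : ℕ} (t : UnitaryMap n) (j : ℕ) : ℕ :=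
  if j ≤ 1 then 0
  else (if Even j then 1 else 0) + ∑ p ∈ Finset.Ico 1 j, orderOf (t (gen n ^ p))

/-- The set `𝒞𝒮(n, k)` of pairs `(t, λ)` of a unitary map `t : C_n → C_2` and `λ ∈ k^*` with
`λ ^ n = (-1) ^ σ_t(n)`. -/
structure CS (n : ℕ) (k : Type u) [Field k] where
  /-- The unitary map `t`. -/
  t : UnitaryMap n
  /-- The scalar `λ`. -/
  lam : kˣ
  /-- `λ` is an `n`-th root of `(-1) ^ σ_t(n)`. -/
  lam_pow : lam ^ n = (-1) ^ sigma t n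

variable {k : Type u} [Field k] {n : ℕ}

/-- The relation `(t, λ) ≈ (t', λ')` on `𝒞𝒮(n, k)`. -/
def CS.Approx (P P' : CS n k) : Prop :=
  ∃ r : UnitaryMap n,
    (∀ i ∈ Finset.Icc 1 n, ∀ j ∈ Finset.Icc 1 n,
      ∏ p ∈ Finset.range i, P.t (gen n ^ p) * P.t (gen n ^ (p + j)) =
        r (gen n ^ i) * r (gen n ^ j) * r (gen n ^ (i + j)) *
          ∏ q ∈ Finset.range i, P'.t (gen n ^ q) * P'.t (gen n ^ (q + j))) ∧
    (∀ i ∈ Finset.Icc 1 n,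
      (-1) ^ (1 + sigma P.t i + orderOf (r (gen n ^ i))) * P.lam ^ i =
        (-1) ^ sigma P'.t i * P'.lam ^ i)

/-- The relation `(t, λ) ≡ (t', λ')` on `𝒞𝒮(n, k)`. -/
def CS.Equi (P P' : CS n k) : Prop :=
  ∃ (β : kˣ) (r : UnitaryMap n) (s : ℕ), s ∈ Finset.Icc 1 n ∧ Nat.gcd s n = 1 ∧
    (∀ i ∈ Finset.Icc 1 n, ∀ j ∈ Finset.Icc 1 n,
      ∏ p ∈ Finset.range i, P.t (gen n ^ p) * P.t (gen n ^ (p + j)) =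
        r (gen n ^ i) * r (gen n ^ j) * r (gen n ^ (i + j)) *
          ∏ q ∈ Finset.range (i * s), P'.t (gen n ^ q) * P'.t (gen n ^ (q + j * s))) ∧
    (∀ i ∈ Finset.Icc 1 n,
      (-1) ^ (1 + sigma P.t i + orderOf (r (gen n ^ i))) * P.lam ^ i * β =
        (-1) ^ sigma P'.t (i * s) * P'.lam ^ (i * s))

/-- The identification of `C_2` with the subgroup `{1, g}` of the units of `H₄`. -/
def embC2 (k : Type u) [Field k] (u : Cyc 2) : SweedlerH4 k :=
  SweedlerH4.g k ^ (Multiplicative.toAdd u).val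

/-- The element `c ^ i` of the group algebra `k[C_n]`. -/
def cpow (k : Type u) [Field k] (n i : ℕ) : MonoidAlgebra k (Cyc n) :=
  MonoidAlgebra.single (gen n ^ i) 1

/-- The crossed system `S = (▷, f)` of `H₄` and `k[C_n]` is the one given by the pair `(t, λ)`:
`c^j ▷ 1 = 1`, `c^j ▷ g = g`, `c^j ▷ x = (-1)^σ_t(j) λ^j x`, `c^j ▷ g x = (-1)^σ_t(j) λ^j g x`, and
`f (c^i, c^j)` is the product of `t(c^p)` for `p < i`, of `t(c^q)` for `q < j` and of `t(c^r)` for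
`r < i + j`. -/
def CrossedSystem.IsGivenBy (S : CrossedSystem k (SweedlerH4 k) (MonoidAlgebra k (Cyc n)))
    (P : CS n k) : Prop :=
  (∀ j ∈ Finset.Icc 1 n,
    S.act (cpow k n j ⊗ₜ 1) = 1 ∧
    S.act (cpow k n j ⊗ₜ SweedlerH4.g k) = SweedlerH4.g k ∧
    S.act (cpow k n j ⊗ₜ SweedlerH4.x k) =
      ((-1) ^ sigma P.t j * (P.lam : k) ^ j) • SweedlerH4.x k ∧
    S.act (cpow k n j ⊗ₜ (SweedlerH4.g k * SweedlerH4.x k)) =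
      ((-1) ^ sigma P.t j * (P.lam : k) ^ j) • (SweedlerH4.g k * SweedlerH4.x k)) ∧
  (∀ i ∈ Finset.Icc 1 n, ∀ j ∈ Finset.Icc 1 n,
    S.coc (cpow k n i ⊗ₜ cpow k n j) =
      embC2 k ((∏ p ∈ Finset.range i, P.t (gen n ^ p)) * (∏ q ∈ Finset.range j, P.t (gen n ^ q)) *
        ∏ r ∈ Finset.range (i + j), P.t (gen n ^ r)))

end Parameters
end
end HopfCrossed

/-!
Write a crossed system of `H₄` and `k[G]`, for any group `G`, in terms of group elements. Each
`u ▷ -` is an injective endomorphism of the Hopf algebra `H₄`, so it fixes the only nontrivial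
group-like element `g`, and as the characteristic is not two it rescales `x` by some `α u` in `k^*`
(`CrossedSystem.ga_eq_scale`). The cocycle takes group-like values, that is, values in `{1, g}`.
Conjugation by `g` changes the sign of `x`, so the twisted module condition reads
`α u * α v = ± α (u v)` with the sign given by `f (u, v)`; since `-1 ≠ 1`, the map `α` determines
`f`. Thus crossed systems correspond to the maps `α : G → k^*` with `α 1 = 1` that are
multiplicative up to signs (`IsSignMul`, `CrossedSystem.exists_scal_eq`).

A change of cocycle by `r : G → {1, g}` multiplies `α` by the signs of `r`, and any signs occur, so
two crossed systems are cohomologous exactly if their maps `α` agree up to signs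
(`CrossedSystem.cohomologous_iff_scal`).

For isomorphisms of crossed products, the group-like elements of the crossed product are `1 # u` and
`g # u`, and a nonzero skew-primitive element that anticommutes with its group-like element can only
be a multiple of `x # 1`, with group-like element `g # 1` (`CrossedProduct.eq_g_and_eq_smul_x`).
So an isomorphism fixes `g # 1`, rescales `x # 1`, and maps `1 # u` to `r u # θ u` for an
automorphism `θ` of `G`; comparing the commutation of `1 # u` with `x # 1` on both sides gives
`α' (θ u) = ± α u`. Conversely such a `θ` yields the isomorphism `a # u ↦ a r(u) # θ(u)`
(`CrossedProduct.nonempty_bialgEquiv_iff`).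

For `G = C_n`, the parity of `σ_t(j)` is that of the number of nontrivial factors in
`t(1) ⋯ t(c^(j-1))` (`neg_one_pow_sigma`), so the pair `(t, λ)` encodes the map
`α (c ^ j) = (-1) ^ σ_t(j) λ ^ j`, well defined because `λ ^ n = (-1) ^ σ_t(n)`, and each `α` that
is multiplicative up to signs arises in this way (`CS.exists_scalar_eq`). The conditions on `λ` in
the relations `≈` and `≡` are the above conditions on `α`, with the automorphisms of `C_n` given by
the exponents prime to `n`; they imply the conditions on `t` (`CS.prod_eq_of_coeff`), and the factor
`β` in `≡` is `1`, as is seen at `c ^ n = 1` (`CS.approx_iff`, `CS.equi_iff`).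
-/

namespace HopfCrossed

noncomputable section

/-! ### Signs and the group-like elements of Sweedler's Hopf algebra -/

section Signs

theorem eq_one_or_eq_gen (w : Cyc 2) : w = 1 ∨ w = gen 2 := by
  revert w; decide

theorem cyc_two_mul_self (w : Cyc 2) : w * w = 1 := by
  revert w; decide

/-- The nontrivial character `C_2 → k^*`, with values `1` and `-1`. -/
def sign (k : Type u) [Field k] : Cyc 2 →* kˣ where
  toFun w := (-1) ^ (Multiplicative.toAdd w).val
  map_one' := by simp
  map_mul' a b := by
    rcases eq_one_or_eq_gen a with rfl | rfl <;> rcases eq_one_or_eq_gen b with rfl | rfl <;>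
      simp [gen, ZMod.val_one, cyc_two_mul_self]

variable {k : Type u} [Field k]

theorem sign_gen : sign k (gen 2) = -1 := by
  simp [sign, gen, ZMod.val_one]

theorem neg_one_ne_one (hk : ringChar k ≠ 2) : (-1 : kˣ) ≠ 1 := fun h =>
  Ring.neg_one_ne_one_of_char_ne_two hk (by simpa using congrArg Units.val h)

theorem sign_injective (hk : ringChar k ≠ 2) : Function.Injective (sign k) := by
  rw [injective_iff_map_eq_one]
  intro w hw
  rcases eq_one_or_eq_gen w with rfl | rfl
  · rfl
  · exact absurd (sign_gen.symm.trans hw) (neg_one_ne_one hk)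

theorem sign_mul_self (w : Cyc 2) : sign k w * sign k w = 1 := by
  rw [← map_mul, cyc_two_mul_self, map_one]

theorem sign_inv (w : Cyc 2) : (sign k w)⁻¹ = sign k w :=
  inv_eq_of_mul_eq_one_left (sign_mul_self w)

theorem neg_one_pow_orderOf (w : Cyc 2) : (-1 : kˣ) ^ orderOf w = -sign k w := by
  rcases eq_one_or_eq_gen w with rfl | rfl
  · simp
  · have : orderOf (gen 2) = 2 := orderOf_eq_prime (by decide) (by decide)
    simp [this, sign_gen]

theorem embC2_one : embC2 k 1 = 1 := by simp [embC2]

theorem embC2_gen : embC2 k (gen 2) = SweedlerH4.g k := by simp [embC2, gen, ZMod.val_one]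

theorem embC2_mul (a b : Cyc 2) : embC2 k (a * b) = embC2 k a * embC2 k b := by
  rcases eq_one_or_eq_gen a with rfl | rfl <;> rcases eq_one_or_eq_gen b with rfl | rfl <;>
    simp [embC2_one, cyc_two_mul_self, embC2_gen, SweedlerH4.g_mul_g]

theorem embC2_mul_self (a : Cyc 2) : embC2 k a * embC2 k a = 1 := by
  rw [← embC2_mul, cyc_two_mul_self, embC2_one]

theorem embC2_mul_g (a : Cyc 2) :
    embC2 k a * SweedlerH4.g k = SweedlerH4.g k * embC2 k a := by
  rcases eq_one_or_eq_gen a with rfl | rfl <;> simp [embC2_one, embC2_gen]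

theorem embC2_mul_x (a : Cyc 2) :
    embC2 k a * SweedlerH4.x k = (sign k a : k) • (SweedlerH4.x k * embC2 k a) := by
  rcases eq_one_or_eq_gen a with rfl | rfl
  · simp [embC2_one]
  · simp [embC2_gen, sign_gen, SweedlerH4.x_mul_g]

theorem isGroupLikeElem_embC2 (a : Cyc 2) : IsGroupLikeElem k (embC2 k a) := by
  rcases eq_one_or_eq_gen a with rfl | rfl
  · rw [embC2_one]; exact .one
  · rw [embC2_gen]; exact ⟨SweedlerH4.counit_g k, SweedlerH4.comul_g k⟩

end Signs

namespace SweedlerH4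

variable {k : Type u} [Field k]

theorem eq_combination (a : SweedlerH4 k) :
    a = (basis k).repr a 0 • 1 + (basis k).repr a 1 • g k + (basis k).repr a 2 • x k +
      (basis k).repr a 3 • (g k * x k) := by
  conv_lhs => rw [← (basis k).sum_repr a]
  simp only [Fin.sum_univ_four, basis_zero, basis_one, basis_two, basis_three]

theorem repr_one : (basis k).repr 1 = Finsupp.single 0 1 := by
  rw [← basis_zero, Module.Basis.repr_self]

theorem repr_g : (basis k).repr (g k) = Finsupp.single 1 1 := by
  rw [← basis_one, Module.Basis.repr_self]

theorem repr_x : (basis k).repr (x k) = Finsupp.single 2 1 := by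
  rw [← basis_two, Module.Basis.repr_self]

theorem repr_gx : (basis k).repr (g k * x k) = Finsupp.single 3 1 := by
  rw [← basis_three, Module.Basis.repr_self]

theorem x_ne_zero : x k ≠ 0 := by
  rw [← basis_two]; exact (basis k).ne_zero 2

theorem g_ne_one : g k ≠ 1 := by
  rw [← basis_one, ← basis_zero]
  exact fun h => by simpa using (basis k).injective h

theorem comul_combination (p q r s : k) :
    comul (R := k) (p • 1 + q • g k + r • x k + s • (g k * x k)) =
      p • (1 ⊗ₜ[k] 1) + q • (g k ⊗ₜ[k] g k) + r • (x k ⊗ₜ[k] 1 + g k ⊗ₜ[k] x k) +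
        s • ((g k * x k) ⊗ₜ[k] g k + 1 ⊗ₜ[k] (g k * x k)) := by
  simp [comul_g, comul_x, mul_add, g_mul_g, Algebra.TensorProduct.one_def]

theorem eq_embC2_of_isGroupLikeElem {a : SweedlerH4 k} (ha : IsGroupLikeElem k a) :
    ∃ w, a = embC2 k w := by
  have h0 := ha.counit_eq_one
  have h := ha.comul_eq_tmul_self
  rw [eq_combination a] at h h0 ⊢
  generalize (basis k).repr a 0 = p at *
  generalize (basis k).repr a 1 = q at *
  generalize (basis k).repr a 2 = r at *
  generalize (basis k).repr a 3 = s at *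
  rw [comul_combination] at h
  have hc (i j : Fin 4) := congrArg (fun z => ((basis k).tensorProduct (basis k)).repr z (i, j)) h
  have h33 := hc 3 3
  have h22 := hc 2 2
  have h01 := hc 0 1
  simp [Module.Basis.tensorProduct_repr_tmul_apply, repr_one, repr_g, repr_x, repr_gx]
    at h33 h22 h01
  simp [counit_g, counit_x] at h0
  subst h33 h22
  rcases h01 with rfl | rfl
  · exact ⟨1, by simp_all [embC2_one]⟩
  · exact ⟨gen 2, by simp_all [embC2_gen]⟩

/-- A `(1, g)`-skew-primitive element of `H₄` has the form `b (1 - g) + c x`, and `1 - g` commutes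
with `g`; away from characteristic two anticommutation with `g` therefore leaves the multiples
of `x`. -/
theorem eq_smul_x_of_skewPrimitive (hk : ringChar k ≠ 2) {a : SweedlerH4 k}
    (ha : comul (R := k) a = a ⊗ₜ 1 + g k ⊗ₜ a) (hg : a * g k = -(g k * a)) :
    ∃ c : k, a = c • x k := by
  rw [eq_combination a] at ha hg ⊢
  generalize (basis k).repr a 0 = p at *
  generalize (basis k).repr a 1 = q at *
  generalize (basis k).repr a 2 = r at *
  generalize (basis k).repr a 3 = s at *
  rw [comul_combination] at ha
  have hc := congrArg (fun z => ((basis k).tensorProduct (basis k)).repr z (3, 0)) ha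
  have h0 := congrArg (fun z => (basis k).repr z 0) hg
  have h1 := congrArg (fun z => (basis k).repr z 1) hg
  simp [Module.Basis.tensorProduct_repr_tmul_apply, repr_one, repr_g, repr_x, repr_gx] at hc
  simp [add_mul, mul_add, g_mul_g, x_mul_g, gg_mul, mul_assoc, repr_one, repr_g, repr_x, repr_gx]
    at h0 h1
  have h2 : (2 : k) ≠ 0 := Ring.two_ne_zero hk
  have hp : p = 0 := by
    have : (2 : k) * p = 0 := by linear_combination h1
    simpa [h2] using this
  have hq : q = 0 := by
    have : (2 : k) * q = 0 := by linear_combination h0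
    simpa [h2] using this
  exact ⟨r, by simp [hp, hq, ← hc]⟩

end SweedlerH4

/-! ### Crossed systems over a group algebra in terms of group elements -/

section GroupCrossedSystems

variable {k : Type u} [Field k] {G : Type w}

/-- The linear map out of `k[G]` with prescribed values on `G`. -/
def extend {M : Type v} [AddCommGroup M] [Module k M] (φ : G → M) : MonoidAlgebra k G →ₗ[k] M :=
  Finsupp.linearCombination k φ ∘ₗ (MonoidAlgebra.coeffLinearEquiv k).toLinearMap

@[simp]
theorem extend_single {M : Type v} [AddCommGroup M] [Module k M] (φ : G → M) (g : G) (c : k) :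
    extend φ (MonoidAlgebra.single g c) = c • φ g := by
  simp [extend]

variable {A : Type v} [Ring A] [HopfAlgebra k A]

/-- The morphism of coalgebras `k[G] ⊗ A → A` given by a family of coalgebra endomorphisms. -/
def actOfFamily (σ : G → A →ₐc[k] A) : MonoidAlgebra k G ⊗[k] A →ₗc[k] A :=
  { TensorProduct.lift (extend fun g => ((σ g : A →ₐ[k] A) : A →ₗ[k] A)) with
    counit_comp := by
      ext g a
      simp
    map_comp_comul := by
      ext g a
      have := (CoalgHomClass.map_comp_comul_apply (σ g) a)
      simp [-CoalgHomClass.map_comp_comul_apply, TensorProduct.comul_tmul] at this ⊢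
      rw [← this]
      induction comul (R := k) a using TensorProduct.induction_on with
      | zero => simp
      | tmul b c => simp
      | add y z hy hz => simp only [TensorProduct.tmul_add, map_add, hy, hz] }

@[simp]
theorem actOfFamily_single (σ : G → A →ₐc[k] A) (g : G) (c : k) (a : A) :
    actOfFamily σ (MonoidAlgebra.single g c ⊗ₜ a) = c • σ g a := by
  change TensorProduct.lift _ _ = _
  simp

/-- The morphism of coalgebras `k[G] ⊗ k[G] → A` given by a family of group-like elements. -/
def cocOfFamily (f : G → G → A) (hf : ∀ g h, IsGroupLikeElem k (f g h)) :
    MonoidAlgebra k G ⊗[k] MonoidAlgebra k G →ₗc[k] A :=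
  { TensorProduct.lift (extend fun g => extend fun h => f g h) with
    counit_comp := by
      ext g h
      simp [(hf g h).counit_eq_one]
    map_comp_comul := by
      ext g h
      simp [(hf g h).comul_eq_tmul_self] }

@[simp]
theorem cocOfFamily_single (f : G → G → A) (hf : ∀ g h, IsGroupLikeElem k (f g h)) (g h : G)
    (c d : k) : cocOfFamily f hf (MonoidAlgebra.single g c ⊗ₜ MonoidAlgebra.single h d) =
      c • d • f g h := by
  change TensorProduct.lift _ _ = _
  simp

variable [Group G]

theorem map_mul_comul_comm (F : MonoidAlgebra k G ⊗[k] MonoidAlgebra k G →ₗ[k] A)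
    (z : MonoidAlgebra k G ⊗[k] MonoidAlgebra k G) :
    TensorProduct.map (LinearMap.mul' k (MonoidAlgebra k G)) F (comul z) =
      TensorProduct.map (LinearMap.mul' k (MonoidAlgebra k G)) F
        (TensorProduct.comm k (MonoidAlgebra k G ⊗[k] MonoidAlgebra k G)
          (MonoidAlgebra k G ⊗[k] MonoidAlgebra k G) (comul z)) := by
  refine LinearMap.congr_fun (f := TensorProduct.map _ _ ∘ₗ comul)
    (g := TensorProduct.map _ _ ∘ₗ (TensorProduct.comm k _ _).toLinearMap ∘ₗ comul) ?_ z
  ext g h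
  simp

/-- A family of bialgebra endomorphisms `σ g` of `A` and of group-like elements `f g h` satisfying
the crossed system identities on `G` extends to a crossed system of `A` and `k[G]`; the
cocentrality conditions are automatic since `k[G]` is cocommutative. -/
def CrossedSystem.ofGroup (σ : G → A →ₐc[k] A) (f : G → G → A)
    (hf : ∀ g h, IsGroupLikeElem k (f g h)) (σ_one : ∀ a, σ 1 a = a)
    (f_one : ∀ g, f g 1 = 1) (one_f : ∀ g, f 1 g = 1)
    (twisted : ∀ g h a, σ g (σ h a) * f g h = f g h * σ (g * h) a)
    (cocycle : ∀ g h l, σ g (f h l) * f g (h * l) = f g h * f (g * h) l) :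
    CrossedSystem k A (MonoidAlgebra k G) where
  act := actOfFamily σ
  coc := cocOfFamily f hf
  one_act a := by
    simp [MonoidAlgebra.one_def, σ_one]
  act_one h := by
    induction h using MonoidAlgebra.induction_linear with
    | zero => simp
    | add => simp_all [TensorProduct.add_tmul]
    | single g c => simp [Algebra.algebraMap_eq_smul_one]
  act_mul a b := by
    ext g
    simp [slice]
  coc_one h := by
    induction h using MonoidAlgebra.induction_linear with
    | zero => simp
    | add => simp_all [TensorProduct.add_tmul]
    | single g c => simp [MonoidAlgebra.one_def, Algebra.algebraMap_eq_smul_one, f_one]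
  one_coc h := by
    induction h using MonoidAlgebra.induction_linear with
    | zero => simp
    | add => simp_all [TensorProduct.tmul_add]
    | single g c => simp [MonoidAlgebra.one_def, Algebra.algebraMap_eq_smul_one, one_f]
  twisted a := by
    ext g h
    simp [slice, twisted]
  cocycle := by
    ext g h l
    simp [killRight, cocycle]
  act_cocentral h a := by rw [Coalgebra.comm_comul]
  coc_cocentral := map_mul_comul_comm _

section

variable (σ : G → A →ₐc[k] A) (f : G → G → A) (hf σ_one f_one one_f twisted cocycle)

@[simp]
theorem CrossedSystem.ofGroup_ga (g : G) (a : A) :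
    (ofGroup σ f hf σ_one f_one one_f twisted cocycle).ga g a = σ g a := by
  simp [ofGroup, ga]

end

theorem CrossedSystem.cohomologous_iff (S S' : CrossedSystem k A (MonoidAlgebra k G)) :
    Cohomologous S S' ↔ ∃ r : G → A, (∀ g, IsGroupLikeElem k (r g)) ∧ r 1 = 1 ∧
      (∀ g a, S'.ga g a = r g * S.ga g a * antipode k (r g)) ∧
      ∀ g h, S'.gf g h = r g * S.ga g (r h) * S.gf g h * antipode k (r (g * h)) := by
  constructor
  · rintro ⟨r, hr1, -, hact, hcoc⟩
    refine ⟨fun g => r (MonoidAlgebra.single g 1), fun g => ?_, hr1, fun g a => ?_, fun g h => ?_⟩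
    · exact (MonoidAlgebra.isGroupLikeElem_single_one g).map r
    · have h := congrArg (fun F => F (MonoidAlgebra.single g (1 : k))) (hact a)
      simpa [slice, ga] using h
    · have h := congrArg
        (fun F => F (MonoidAlgebra.single g (1 : k) ⊗ₜ MonoidAlgebra.single h (1 : k))) hcoc
      simpa [slice, ga, gf, killRight] using h
  · rintro ⟨r, hr, hr1, hact, hcoc⟩
    refine ⟨{ extend r with
      counit_comp := by ext g; simp [(hr g).counit_eq_one]
      map_comp_comul := by ext g; simp [(hr g).comul_eq_tmul_self] }, ?_, ?_, ?_, ?_⟩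
    · change extend r 1 = 1
      simp [MonoidAlgebra.one_def, hr1]
    · intro h
      rw [Coalgebra.comm_comul]
    · intro a
      ext g
      simpa [slice, ga] using hact g a
    · ext g h
      simpa [slice, ga, gf, killRight] using hcoc g h

end GroupCrossedSystems

/-! ### Crossed systems of Sweedler's Hopf algebra and a group algebra -/

namespace SweedlerH4

variable {k : Type u} [Field k]

/-- The Hopf algebra endomorphism of `H₄` with `g ↦ g` and `x ↦ c x`. -/
def scale (c : k) : SweedlerH4 k →ₐc[k] SweedlerH4 k :=
  .ofAlgHom (lift k (g k) (c • x k) (g_mul_g k) (by simp [x_mul_x]) (by simp [x_mul_g]))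
    (algHom_ext k (by simp [lift_g]) (by simp [lift_x, counit_x]))
    (algHom_ext k (by simp [lift_g, comul_g])
      (by simp [lift_x, lift_g, comul_x, TensorProduct.smul_tmul']))

@[simp]
theorem scale_g (c : k) : scale c (g k) = g k :=
  lift_g k (g k) (c • x k) (g_mul_g k) (by simp [x_mul_x]) (by simp [x_mul_g])

@[simp]
theorem scale_x (c : k) : scale c (x k) = c • x k :=
  lift_x k (g k) (c • x k) (g_mul_g k) (by simp [x_mul_x]) (by simp [x_mul_g])

theorem scale_scale (c d : k) (a : SweedlerH4 k) : scale c (scale d a) = scale (c * d) a := by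
  have : (scale c : SweedlerH4 k →ₐ[k] SweedlerH4 k).comp
      (scale d : SweedlerH4 k →ₐ[k] SweedlerH4 k) =
      (scale (c * d) : SweedlerH4 k →ₐ[k] SweedlerH4 k) :=
    algHom_ext k (by simp) (by simp [smul_smul, mul_comm])
  exact DFunLike.congr_fun this a

theorem scale_one (a : SweedlerH4 k) : scale 1 a = a := by
  have : (scale (1 : k) : SweedlerH4 k →ₐ[k] SweedlerH4 k) = AlgHom.id k _ :=
    algHom_ext k (by simp) (by simp)
  exact DFunLike.congr_fun this a

@[simp]
theorem scale_embC2 (c : k) (w : Cyc 2) : scale c (embC2 k w) = embC2 k w := by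
  rcases eq_one_or_eq_gen w with rfl | rfl
  · rw [embC2_one, map_one]
  · rw [embC2_gen, scale_g]

/-- Conjugation by the group-like element `w` rescales `x` by the sign of `w`. -/
theorem embC2_mul_eq (w : Cyc 2) (a : SweedlerH4 k) :
    embC2 k w * a = scale (sign k w : k) a * embC2 k w := by
  rw [eq_combination a]
  simp only [mul_add, map_add, add_mul, map_smul, map_one, one_mul, mul_one, map_mul, scale_g,
    scale_x, mul_smul_comm, smul_mul_assoc, ← mul_assoc, embC2_mul_g]
  simp only [mul_assoc, embC2_mul_x, mul_smul_comm]

theorem antipode_embC2 (w : Cyc 2) : antipode k (embC2 k w) = embC2 k w := by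
  rcases eq_one_or_eq_gen w with rfl | rfl
  · rw [embC2_one, antipode_one]
  · rw [embC2_gen]; exact antipodeMap_g k

end SweedlerH4

/-- A map `α : G → k^*` that is multiplicative up to signs, with `α 1 = 1`. -/
def IsSignMul {k : Type u} [Field k] {G : Type w} [Group G] (α : G → kˣ) : Prop :=
  α 1 = 1 ∧ ∀ u v, ∃ w, α u * α v = sign k w * α (u * v)

namespace CrossedSystem

open SweedlerH4

variable {k : Type u} [Field k] {G : Type w} [Group G]

section Scalar

variable (S : CrossedSystem k (SweedlerH4 k) (MonoidAlgebra k G))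

theorem exists_gf (u v : G) : ∃ w, S.gf u v = embC2 k w :=
  eq_embC2_of_isGroupLikeElem (CrossedProduct.isGroupLikeElem_gf S u v)

theorem ga_smul (u : G) (c : k) (a : SweedlerH4 k) : S.ga u (c • a) = c • S.ga u a :=
  (CrossedProduct.gaₗ S u).map_smul c a

theorem ga_zero (u : G) : S.ga u 0 = 0 :=
  (CrossedProduct.gaₗ S u).map_zero

theorem ga_inv_ga (u : G) (a : SweedlerH4 k) :
    S.ga u⁻¹ (S.ga u a) * S.gf u⁻¹ u = S.gf u⁻¹ u * a := by
  rw [S.ga_ga, inv_mul_cancel, S.one_ga]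

theorem ga_g (u : G) : S.ga u (g k) = g k := by
  have hg : IsGroupLikeElem k (S.ga u (g k)) :=
    ⟨by rw [CrossedProduct.counit_ga, counit_g], by
      rw [CrossedProduct.comul_ga, comul_g]; rfl⟩
  obtain ⟨w, hw⟩ := eq_embC2_of_isGroupLikeElem hg
  rcases eq_one_or_eq_gen w with rfl | rfl
  · have h := S.ga_inv_ga u (g k)
    obtain ⟨w', hw'⟩ := S.exists_gf u⁻¹ u
    rw [hw, embC2_one, S.ga_one, one_mul, hw'] at h
    have h' := congrArg (embC2 k w' * ·) h
    simp only [← mul_assoc, embC2_mul_self, one_mul] at h'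
    exact absurd h'.symm g_ne_one
  · rw [hw, embC2_gen]

theorem exists_ga_x (hk : ringChar k ≠ 2) (u : G) : ∃ c : kˣ, S.ga u (x k) = (c : k) • x k := by
  obtain ⟨c, hc⟩ := eq_smul_x_of_skewPrimitive hk (a := S.ga u (x k))
    (by
      rw [CrossedProduct.comul_ga, comul_x, map_add, TensorProduct.map_tmul,
        TensorProduct.map_tmul]
      change S.ga u (x k) ⊗ₜ S.ga u 1 + S.ga u (g k) ⊗ₜ S.ga u (x k) = _
      rw [S.ga_one, S.ga_g])
    (by
      have h := congrArg (S.ga u) (x_mul_g k)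
      rw [← neg_one_smul k, S.ga_smul, S.ga_mul, S.ga_mul, S.ga_g, neg_one_smul] at h
      exact h)
  refine ⟨Units.mk0 c ?_, hc⟩
  rintro rfl
  have h := S.ga_inv_ga u (x k)
  obtain ⟨w', hw'⟩ := S.exists_gf u⁻¹ u
  rw [hc, zero_smul, S.ga_zero, zero_mul, hw'] at h
  have h' := congrArg (embC2 k w' * ·) h
  simp only [← mul_assoc, embC2_mul_self, one_mul, mul_zero] at h'
  exact x_ne_zero h'.symm

/-- The scalar by which the group element `u` acts on the skew-primitive generator `x`. -/
def scal (hk : ringChar k ≠ 2) (u : G) : kˣ := (S.exists_ga_x hk u).choose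

variable (hk : ringChar k ≠ 2)

theorem ga_x (u : G) : S.ga u (x k) = (S.scal hk u : k) • x k :=
  (S.exists_ga_x hk u).choose_spec

theorem scal_eq_of_ga_x {u : G} {c : kˣ} (h : S.ga u (x k) = (c : k) • x k) :
    S.scal hk u = c :=
  Units.ext (smul_left_injective k x_ne_zero ((S.ga_x hk u).symm.trans h))

theorem ga_eq_scale (u : G) (a : SweedlerH4 k) : S.ga u a = scale (S.scal hk u : k) a := by
  have : AlgHom.ofLinearMap (CrossedProduct.gaₗ S u) (S.ga_one u) (S.ga_mul u) =
      (scale (S.scal hk u : k) : SweedlerH4 k →ₐ[k] SweedlerH4 k) :=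
    algHom_ext k ((S.ga_g u).trans (scale_g _).symm) ((S.ga_x hk u).trans (scale_x _).symm)
  exact DFunLike.congr_fun this a

theorem scal_one : S.scal hk 1 = 1 :=
  S.scal_eq_of_ga_x hk (by rw [S.one_ga]; simp)

/-- The twisted module condition on `x`: as conjugation by `g` changes the sign of `x`, the cocycle
measures the failure of the scalars to be multiplicative. -/
theorem scal_mul_scal {u v : G} {w : Cyc 2} (hw : S.gf u v = embC2 k w) :
    S.scal hk u * S.scal hk v = sign k w * S.scal hk (u * v) := by
  have h := S.ga_ga u v (x k)
  rw [S.ga_x hk v, S.ga_smul, S.ga_x hk u, S.ga_x hk (u * v), hw, mul_smul_comm, embC2_mul_x,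
    smul_smul, smul_smul, smul_mul_assoc] at h
  have h' := congrArg (· * embC2 k w) h
  simp only [smul_mul_assoc, mul_assoc, embC2_mul_self, mul_one] at h'
  ext
  have := smul_left_injective k x_ne_zero h'
  push_cast
  linear_combination this

theorem isSignMul_scal : IsSignMul (S.scal hk) :=
  ⟨S.scal_one hk, fun u v => (S.exists_gf u v).imp fun _ h => S.scal_mul_scal hk h⟩

theorem gf_eq_of_scal {u v : G} {w : Cyc 2}
    (h : S.scal hk u * S.scal hk v = sign k w * S.scal hk (u * v)) : S.gf u v = embC2 k w := by
  obtain ⟨w', hw'⟩ := S.exists_gf u v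
  have h' := S.scal_mul_scal hk hw'
  rw [hw', sign_injective hk (mul_right_cancel (h'.symm.trans h))]

end Scalar

variable (hk : ringChar k ≠ 2)

theorem exists_scal_eq {α : G → kˣ} (hα : IsSignMul α) :
    ∃ S : CrossedSystem k (SweedlerH4 k) (MonoidAlgebra k G), S.scal hk = α := by
  obtain ⟨h1, hm⟩ := hα
  choose φ hφ using hm
  have hφ' (u v : G) : sign k (φ u v) = α u * α v * (α (u * v))⁻¹ := by simp [hφ]
  refine ⟨ofGroup (fun u => scale (α u : k)) (fun u v => embC2 k (φ u v))
    (fun u v => isGroupLikeElem_embC2 _) (fun a => ?_) (fun u => ?_) (fun u => ?_)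
    (fun u v a => ?_) (fun u v l => ?_), funext fun u => scal_eq_of_ga_x _ hk ?_⟩
  · rw [h1, Units.val_one, scale_one]
  · rw [← embC2_one]
    exact congrArg _ (sign_injective hk (by simp [hφ', h1]))
  · rw [← embC2_one]
    exact congrArg _ (sign_injective hk (by simp [hφ', h1]))
  · rw [scale_scale, embC2_mul_eq, scale_scale, ← Units.val_mul, ← Units.val_mul, hφ]
  · rw [scale_embC2, ← embC2_mul, ← embC2_mul]
    refine congrArg _ (sign_injective hk ?_)
    simp only [map_mul, hφ', mul_assoc u v l]
    ext
    push_cast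
    field_simp
  · rw [ofGroup_ga, scale_x]

/-- Changing a crossed system by `r : G → {1, g}` multiplies its scalars by the signs of `r`. -/
theorem cohomologous_iff_scal (S S' : CrossedSystem k (SweedlerH4 k) (MonoidAlgebra k G)) :
    Cohomologous S S' ↔ ∀ u, ∃ w, S'.scal hk u = sign k w * S.scal hk u := by
  rw [cohomologous_iff]
  constructor
  · rintro ⟨r, hr, -, hact, -⟩ u
    obtain ⟨w, hw⟩ := eq_embC2_of_isGroupLikeElem (hr u)
    refine ⟨w, S'.scal_eq_of_ga_x hk ?_⟩
    rw [hact, hw, antipode_embC2, S.ga_eq_scale hk, embC2_mul_eq, mul_assoc, embC2_mul_self,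
      mul_one, scale_scale, scale_x, Units.val_mul]
  · intro h
    choose r hr using h
    have hr' (u : G) : sign k (r u) = S'.scal hk u * (S.scal hk u)⁻¹ := by simp [hr]
    refine ⟨fun u => embC2 k (r u), fun u => isGroupLikeElem_embC2 _, ?_, fun u a => ?_,
      fun u v => ?_⟩
    · rw [← embC2_one]
      exact congrArg _ (sign_injective hk (by simp [hr', scal_one]))
    · rw [antipode_embC2, S.ga_eq_scale hk, embC2_mul_eq, mul_assoc, embC2_mul_self,
        mul_one, scale_scale, S'.ga_eq_scale hk, hr, Units.val_mul]
    · obtain ⟨w, hw⟩ := S.exists_gf u v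
      obtain ⟨w', hw'⟩ := S'.exists_gf u v
      rw [antipode_embC2, S.ga_eq_scale hk, scale_embC2, hw, hw', ← embC2_mul, ← embC2_mul,
        ← embC2_mul]
      refine congrArg _ (sign_injective hk ?_)
      rw [map_mul, map_mul, map_mul, eq_mul_inv_of_mul_eq (S.scal_mul_scal hk hw).symm,
        eq_mul_inv_of_mul_eq (S'.scal_mul_scal hk hw').symm, ← sign_inv (r (u * v)), hr', hr', hr']
      ext
      push_cast
      field_simp

theorem equivalence_cohomologous (hk : ringChar k ≠ 2) : Equivalence
    (Cohomologous (k := k) (A := SweedlerH4 k) (H := MonoidAlgebra k G)) where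
  refl S := (cohomologous_iff_scal hk S S).2 fun u => ⟨1, by simp⟩
  symm {S S'} h := by
    rw [cohomologous_iff_scal hk] at h ⊢
    exact fun u => (h u).imp fun w hw => by rw [hw, ← mul_assoc, sign_mul_self, one_mul]
  trans {S S' S''} h h' := by
    rw [cohomologous_iff_scal hk] at h h' ⊢
    intro u
    obtain ⟨w, hw⟩ := h u
    obtain ⟨w', hw'⟩ := h' u
    exact ⟨w' * w, by rw [hw', hw, map_mul, mul_assoc]⟩

end CrossedSystem

/-! ### Group-like and skew-primitive elements of crossed products -/

namespace CrossedProduct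

section Coefficients

variable {k : Type u} {A : Type v} {G : Type w} [Field k] [Ring A] [HopfAlgebra k A] [Group G]
  (S : CrossedSystem k A (MonoidAlgebra k G))

open Classical in
/-- The coefficients in `A` of an element of the crossed product, a left `A`-module with basis
`1 # u` for `u` in `G`. -/
def coeffs : CrossedProduct S ≃ₗ[k] G →₀ A :=
  (LinearEquiv.lTensor A (MonoidAlgebra.coeffLinearEquiv k) :
    A ⊗[k] MonoidAlgebra k G ≃ₗ[k] A ⊗[k] (G →₀ k)).trans
      (TensorProduct.finsuppScalarRight k k A G)

variable {S}

@[simp]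
theorem coeffs_el (a : A) (u : G) : coeffs S (el a u) = Finsupp.single u a := by
  classical
  refine (TensorProduct.finsuppScalarRight_apply_tmul _ _).trans ?_
  simp

theorem el_injective (u : G) : Function.Injective fun a : A => (el a u : CrossedProduct S) :=
  fun a b h => Finsupp.single_injective u (by simpa using congrArg (coeffs S) h)

theorem eq_of_el_eq_el {a b : A} {u v : G} (ha : a ≠ 0)
    (h : (el a u : CrossedProduct S) = el b v) : u = v := by
  have h' := congrArg (coeffs S) h
  rw [coeffs_el, coeffs_el, Finsupp.single_eq_single_iff] at h'
  exact (h'.resolve_right fun h0 => ha h0.1).1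

variable (S) in
/-- The coefficient of `u` in an element of the crossed product. -/
def proj (u : G) : CrossedProduct S →ₗ[k] A := Finsupp.lapply u ∘ₗ (coeffs S).toLinearMap

open Classical in
theorem proj_el (u v : G) (a : A) :
    proj S u (el a v) = if v = u then a else 0 := by
  simp [proj, Finsupp.single_apply]

@[simp]
theorem proj_el_self (u : G) (a : A) : proj S u (el a u) = a := by simp [proj_el]

theorem proj_el_of_ne {u v : G} (h : v ≠ u) (a : A) : proj S u (el a v) = 0 := by
  simp [proj_el, h]

theorem ext_proj {y z : CrossedProduct S} (h : ∀ u, proj S u y = proj S u z) : y = z :=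
  (coeffs S).injective (Finsupp.ext h)

theorem map_proj_comul_self (u : G) (z : CrossedProduct S) :
    TensorProduct.map (proj S u) (proj S u) (comul z) = comul (R := k) (proj S u z) := by
  refine induction (p := fun z => TensorProduct.map (proj S u) (proj S u) (comul z) =
    comul (R := k) (proj S u z)) z (by simp) (fun y z hy hz => by simp only [map_add, hy, hz])
    fun a v => ?_
  rw [comul_el]
  by_cases h : v = u
  · subst h
    rw [proj_el_self]
    induction comul (R := k) a using TensorProduct.induction_on with
    | zero => simp
    | tmul b c => simp [diag_tmul]
    | add y z hy hz => simp only [map_add, hy, hz]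
  · rw [proj_el_of_ne h, map_zero]
    induction comul (R := k) a using TensorProduct.induction_on with
    | zero => simp
    | tmul b c => simp [diag_tmul, proj_el_of_ne h]
    | add y z hy hz => simp only [map_add, hy, hz, add_zero]

theorem map_proj_comul_of_ne {u v : G} (huv : u ≠ v) (z : CrossedProduct S) :
    TensorProduct.map (proj S u) (proj S v) (comul z) = 0 := by
  refine induction (p := fun z => TensorProduct.map (proj S u) (proj S v) (comul z) = 0) z
    (by simp) (fun y z hy hz => by simp only [map_add, hy, hz, add_zero]) fun a w => ?_
  rw [comul_el]
  induction comul (R := k) a using TensorProduct.induction_on with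
  | zero => simp
  | tmul b c =>
    rw [diag_tmul, TensorProduct.map_tmul]
    by_cases h : w = u
    · rw [proj_el_of_ne (h.trans_ne huv), TensorProduct.tmul_zero]
    · rw [proj_el_of_ne h, TensorProduct.zero_tmul]
  | add y z hy hz => simp only [map_add, hy, hz, add_zero]

theorem eq_smul_of_comul_eq_tmul_left {a b : A} (h : comul (R := k) a = b ⊗ₜ a) :
    a = (counit (R := k) a) • b := by
  have := congrArg (TensorProduct.rid k A) (lTensor_counit_comul (R := k) a)
  simpa [h] using this.symm

theorem eq_smul_of_comul_eq_tmul_right {a b : A} (h : comul (R := k) a = a ⊗ₜ b) :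
    a = (counit (R := k) a) • b := by
  have := congrArg (TensorProduct.lid k A) (rTensor_counit_comul (R := k) a)
  simpa [h] using this.symm

theorem exists_eq_el_of_isGroupLikeElem {z : CrossedProduct S} (hz : IsGroupLikeElem k z) :
    ∃ a u, IsGroupLikeElem k a ∧ z = el a u := by
  have hdiag (u : G) : comul (R := k) (proj S u z) = proj S u z ⊗ₜ proj S u z := by
    rw [← map_proj_comul_self, hz.comul_eq_tmul_self, TensorProduct.map_tmul]
  have hne : ∃ u, counit (R := k) (proj S u z) ≠ 0 := by
    by_contra! h
    have : z = 0 := ext_proj fun u => by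
      rw [eq_smul_of_comul_eq_tmul_left (hdiag u), h, zero_smul, map_zero]
    simpa [this] using hz.counit_eq_one
  obtain ⟨u, hu⟩ := hne
  have hzu : z = el (proj S u z) u := by
    refine ext_proj fun v => ?_
    by_cases h : u = v
    · subst h; rw [proj_el_self]
    · rw [proj_el_of_ne h]
      have e := map_proj_comul_of_ne h z
      rw [hz.comul_eq_tmul_self, TensorProduct.map_tmul] at e
      have e' := congrArg (TensorProduct.lid k A ∘ counit.rTensor A) e
      simpa [hu] using e'
  refine ⟨proj S u z, u, ⟨?_, ?_⟩, hzu⟩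
  · rw [← counit_el (S := S) _ u, ← hzu, hz.counit_eq_one]
  · exact hdiag u

theorem isGroupLikeElem_el {a : A} (ha : IsGroupLikeElem k a) (u : G) :
    IsGroupLikeElem k (el a u : CrossedProduct S) :=
  ⟨by rw [counit_el, ha.counit_eq_one], by rw [comul_el, ha.comul_eq_tmul_self, diag_tmul]⟩

section SkewPrimitive

variable {z : CrossedProduct S} {b : A} {u : G}
  (hz : comul (R := k) z = z ⊗ₜ 1 + el b u ⊗ₜ z)
include hz

theorem comul_proj_of_skewPrimitive (v : G) : comul (R := k) (proj S v z) =
    proj S v z ⊗ₜ proj S v 1 + proj S v (el b u) ⊗ₜ proj S v z := by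
  rw [← map_proj_comul_self, hz, map_add, TensorProduct.map_tmul, TensorProduct.map_tmul]

theorem proj_eq_zero_of_skewPrimitive {v : G} (hv : 1 ≠ v) (hu : u ≠ v) : proj S v z = 0 := by
  have h := comul_proj_of_skewPrimitive hz v
  rw [one_def, proj_el_of_ne hv, proj_el_of_ne hu, TensorProduct.zero_tmul, add_zero] at h
  simpa using eq_smul_of_comul_eq_tmul_right h

theorem eq_el_of_skewPrimitive (hu : u = 1) :
    ∃ a : A, z = el a 1 ∧ comul (R := k) a = a ⊗ₜ 1 + b ⊗ₜ a := by
  subst hu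
  refine ⟨proj S 1 z, ext_proj fun v => ?_, ?_⟩
  · by_cases h : 1 = v
    · subst h; rw [proj_el_self]
    · rw [proj_el_of_ne h, proj_eq_zero_of_skewPrimitive hz h h]
  · simpa [one_def] using comul_proj_of_skewPrimitive hz 1

/-- Over a group-like element that lies over `u ≠ 1` all skew-primitive elements are trivial. -/
theorem eq_add_of_skewPrimitive (hu : u ≠ 1) : ∃ p q : k, z = p • el b u + q • 1 := by
  refine ⟨counit (R := k) (proj S u z), counit (R := k) (proj S 1 z), ext_proj fun v => ?_⟩
  have h := comul_proj_of_skewPrimitive hz v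
  rw [map_add, map_smul, map_smul]
  rw [one_def] at h ⊢
  by_cases h1 : 1 = v
  · subst h1
    rw [proj_el_of_ne hu, TensorProduct.zero_tmul, add_zero, proj_el_self] at h
    rw [proj_el_of_ne hu, proj_el_self, smul_zero, zero_add]
    exact eq_smul_of_comul_eq_tmul_right h
  · by_cases h2 : u = v
    · subst h2
      rw [proj_el_of_ne h1, TensorProduct.tmul_zero, zero_add, proj_el_self] at h
      rw [proj_el_of_ne h1, proj_el_self, smul_zero, add_zero]
      exact eq_smul_of_comul_eq_tmul_left h
    · rw [proj_el_of_ne h1, proj_el_of_ne h2, proj_eq_zero_of_skewPrimitive hz h1 h2]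
      simp

end SkewPrimitive

end Coefficients

open SweedlerH4

variable {k : Type u} {G : Type w} [Field k] [Group G]
  {S S' : CrossedSystem k (SweedlerH4 k) (MonoidAlgebra k G)}

theorem el_smul (c : k) (a : SweedlerH4 k) (u : G) :
    (el (c • a) u : CrossedProduct S) = c • el a u :=
  (elₗ S u).map_smul c a

theorem el_neg (a : SweedlerH4 k) (u : G) :
    (el (-a) u : CrossedProduct S) = -el a u :=
  (elₗ S u).map_neg a

theorem comul_el_x : comul (R := k) (el (x k) 1 : CrossedProduct S) =
    el (x k) 1 ⊗ₜ 1 + el (g k) 1 ⊗ₜ el (x k) 1 := by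
  rw [comul_el, comul_x, map_add, diag_tmul, diag_tmul, one_def]

theorem exists_eq_el_embC2 {z : CrossedProduct S} (hz : IsGroupLikeElem k z) :
    ∃ w u, z = el (embC2 k w) u := by
  obtain ⟨a, u, ha, rfl⟩ := exists_eq_el_of_isGroupLikeElem hz
  obtain ⟨w, rfl⟩ := eq_embC2_of_isGroupLikeElem ha
  exact ⟨w, u, rfl⟩

/-- The pair `(g, x)` is recognized in the crossed product, up to a scalar in `x`, by the Hopf
algebra structure alone. -/
theorem eq_g_and_eq_smul_x (hk : ringChar k ≠ 2) {h z : CrossedProduct S}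
    (hh : IsGroupLikeElem k h) (h1 : h ≠ 1) (hz : comul (R := k) z = z ⊗ₜ 1 + h ⊗ₜ z)
    (hzh : z * h = -(h * z)) (z0 : z ≠ 0) :
    h = el (g k) 1 ∧ ∃ c : k, c ≠ 0 ∧ z = c • el (x k) 1 := by
  obtain ⟨w, u, rfl⟩ := exists_eq_el_embC2 hh
  by_cases hu : u = 1
  · subst hu
    rcases eq_one_or_eq_gen w with rfl | rfl
    · exact absurd (by rw [embC2_one, one_def]) h1
    · rw [embC2_gen] at hz hzh ⊢
      obtain ⟨a, rfl, ha⟩ := eq_el_of_skewPrimitive hz rfl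
      rw [el_one_mul_el_one, el_one_mul_el_one, ← el_neg] at hzh
      obtain ⟨c, rfl⟩ := eq_smul_x_of_skewPrimitive hk ha (el_injective 1 hzh)
      refine ⟨rfl, c, ?_, el_smul c _ 1⟩
      rintro rfl
      exact z0 (by rw [el_smul, zero_smul])
  · obtain ⟨p, q, hpq⟩ := eq_add_of_skewPrimitive hz hu
    have hc : z * el (embC2 k w) u = el (embC2 k w) u * z := by rw [hpq]; simp [mul_add, add_mul]
    rw [hc, eq_neg_iff_add_eq_zero, ← two_smul k, smul_eq_zero_iff_right (Ring.two_ne_zero hk),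
      hh.isUnit.mul_right_eq_zero] at hzh
    exact absurd hzh z0

end CrossedProduct

/-! ### Isomorphisms of crossed products -/

namespace CrossedProduct

open SweedlerH4

variable {k : Type u} {G : Type w} [Field k] [Group G]
  {S S' : CrossedSystem k (SweedlerH4 k) (MonoidAlgebra k G)}

theorem embC2_ne_zero (w : Cyc 2) : embC2 k w ≠ 0 :=
  (isGroupLikeElem_embC2 w).ne_zero

theorem exists_mulEquiv_of_bialgEquiv (hk : ringChar k ≠ 2)
    (ψ : CrossedProduct S ≃ₐc[k] CrossedProduct S') :
    ∃ θ : G ≃* G, ∀ u, ∃ w, S'.scal hk (θ u) = sign k w * S.scal hk u := by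
  obtain ⟨hg, c, hc, hx⟩ := eq_g_and_eq_smul_x hk (h := ψ (el (g k) 1)) (z := ψ (el (x k) 1))
    ((isGroupLikeElem_el ⟨counit_g k, comul_g k⟩ 1).map ψ)
    (by
      rw [← map_one ψ, one_def]
      exact fun h => g_ne_one (el_injective 1 (ψ.injective h)))
    (by
      rw [← CoalgHomClass.map_comp_comul_apply, comul_el_x]
      simp)
    (by rw [← map_mul, ← map_mul, ← map_neg, el_one_mul_el_one, el_one_mul_el_one, x_mul_g, el_neg])
    (by
      intro h
      have h' : (el (x k) 1 : CrossedProduct S) = el 0 1 :=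
        ψ.injective (h.trans (by rw [show (el 0 1 : CrossedProduct S) = 0 from
          (elₗ S 1).map_zero, map_zero]))
      exact x_ne_zero (el_injective 1 h'))
  have he (w : Cyc 2) : ψ (el (embC2 k w) 1) = el (embC2 k w) 1 := by
    rcases eq_one_or_eq_gen w with rfl | rfl
    · rw [embC2_one]; exact map_one ψ
    · rw [embC2_gen, hg]
  have hu (u : G) : ∃ w v, ψ (el 1 u) = el (embC2 k w) v :=
    exists_eq_el_embC2 ((isGroupLikeElem_el .one u).map ψ)
  choose r θ hθ using hu
  have hψ (w : Cyc 2) (u : G) : ψ (el (embC2 k w) u) = el (embC2 k (w * r u)) (θ u) := by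
    rw [el_eq, map_mul, he, hθ, el_mul_el, S'.one_ga, S'.one_gf, mul_one, ← embC2_mul, one_mul]
  have hmul (u v : G) : θ (u * v) = θ u * θ v := by
    have h := map_mul ψ (el 1 u) (el 1 v)
    obtain ⟨w, hw⟩ := S.exists_gf u v
    obtain ⟨w', hw'⟩ := S'.exists_gf (θ u) (θ v)
    rw [el_mul_el, S.ga_one, one_mul, one_mul, hw, hψ, hθ, hθ, el_mul_el, S'.ga_eq_scale hk,
      scale_embC2, hw'] at h
    exact eq_of_el_eq_el (embC2_ne_zero _) h
  have hinj : Function.Injective θ := by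
    intro u v huv
    have h : ψ (el (embC2 k (r u * r v)) v) = ψ (el 1 u) := by
      rw [hψ, hθ, mul_assoc, cyc_two_mul_self, mul_one, huv]
    exact (eq_of_el_eq_el (embC2_ne_zero _) (ψ.injective h)).symm
  have hsurj : Function.Surjective θ := by
    intro v
    obtain ⟨w, u, h⟩ := exists_eq_el_embC2 ((isGroupLikeElem_el (S := S') .one v).map ψ.symm)
    have h' := congrArg ψ h
    rw [hψ] at h'
    have e : ψ (ψ.symm (el 1 v)) = el 1 v := ψ.toEquiv.apply_symm_apply _
    exact ⟨u, (eq_of_el_eq_el (IsGroupLikeElem.one.ne_zero (R := k)) (e.symm.trans h')).symm⟩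
  refine ⟨MulEquiv.ofBijective (MonoidHom.mk' θ hmul) ⟨hinj, hsurj⟩, fun u => ⟨r u, ?_⟩⟩
  -- Apply `ψ` to the relation `(1 # u) (x # 1) = α u • (x # 1) (1 # u)`.
  have h : (el 1 u * el (x k) 1 : CrossedProduct S) =
      (S.scal hk u : k) • (el (x k) 1 * el 1 u) := by
    rw [el_mul_el, el_mul_el, S.gf_one, S.one_gf, S.ga_x hk, S.one_ga, ← el_smul]
    simp
  have h' := congrArg ψ h
  rw [map_smul, map_mul, map_mul, hx, hθ, mul_smul_comm, smul_mul_assoc, smul_comm _ c] at h'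
  have h'' := smul_right_injective _ hc h'
  rw [el_mul_el, el_mul_el, S'.gf_one, S'.one_gf, S'.ga_x hk, S'.one_ga, mul_one, mul_one,
    ← el_smul, mul_one, one_mul, mul_smul_comm, embC2_mul_x, smul_smul] at h''
  have h3 := congrArg (· * embC2 k (r u)) (el_injective _ h'')
  simp only [smul_mul_assoc, mul_assoc, embC2_mul_self, mul_one] at h3
  have h4 : S'.scal hk (θ u) * sign k (r u) = S.scal hk u :=
    Units.ext (smul_left_injective k x_ne_zero h3)
  change S'.scal hk (θ u) = _
  rw [← h4, mul_comm, mul_assoc, sign_mul_self, mul_one]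

section Twist

variable (S S') in
/-- The linear map `a # u ↦ a r(u) # θ(u)` between crossed products. -/
def twist (r : G → Cyc 2) (θ : G → G) : CrossedProduct S →ₗ[k] CrossedProduct S' :=
  TensorProduct.lift
    (extend (k := k) fun u => elₗ S' (θ u) ∘ₗ LinearMap.mulRight k (embC2 k (r u))).flip

@[simp]
theorem twist_el (r : G → Cyc 2) (θ : G → G) (a : SweedlerH4 k) (u : G) :
    twist S S' r θ (el a u) = el (a * embC2 k (r u)) (θ u) := by
  refine (TensorProduct.lift.tmul _ _).trans ?_
  rw [LinearMap.flip_apply, extend_single, one_smul]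
  rfl

theorem hom_ext {M : Type v} [AddCommGroup M] [Module k M] {F F' : CrossedProduct S →ₗ[k] M}
    (h : ∀ a u, F (el a u) = F' (el a u)) : F = F' := by
  ext z
  exact induction (p := fun z => F z = F' z) z (by simp)
    (fun y z hy hz => by simp only [map_add, hy, hz]) h

theorem twist_twist (r r' : G → Cyc 2) (θ θ' : G → G) (hr : ∀ u, r' (θ u) = r u)
    (hθ : ∀ u, θ' (θ u) = u) (z : CrossedProduct S) :
    twist S' S r' θ' (twist S S' r θ z) = z := by
  have : twist S' S r' θ' ∘ₗ twist S S' r θ = LinearMap.id :=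
    hom_ext fun a u => by
      simp [hr, hθ, mul_assoc, embC2_mul_self]
  exact LinearMap.congr_fun this z

variable (hk : ringChar k ≠ 2) {r : G → Cyc 2} {θ : G ≃* G}
  (h : ∀ u, S'.scal hk (θ u) = sign k (r u) * S.scal hk u)
include h

theorem twist_one : twist S S' r θ 1 = 1 := by
  have : r 1 = 1 := sign_injective hk (by
    have := h 1
    rw [map_one, S.scal_one, S'.scal_one, mul_one] at this
    rw [← this, map_one])
  rw [one_def, twist_el, this, embC2_one, map_one, one_mul, one_def]

theorem twist_mul (y z : CrossedProduct S) :
    twist S S' r θ (y * z) = twist S S' r θ y * twist S S' r θ z := by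
  have hs (u : G) : sign k (r u) = S'.scal hk (θ u) * (S.scal hk u)⁻¹ := by simp [h]
  refine induction (p := fun y => twist S S' r θ (y * z) = twist S S' r θ y * twist S S' r θ z) y
    (by simp) (fun y y' hy hy' => by simp only [add_mul, map_add, hy, hy']) fun a u => ?_
  refine induction (p := fun z => twist S S' r θ (el a u * z) =
    twist S S' r θ (el a u) * twist S S' r θ z) z
    (by simp) (fun y y' hy hy' => by simp only [mul_add, map_add, hy, hy']) fun b v => ?_
  obtain ⟨w, hw⟩ := S.exists_gf u v
  obtain ⟨w', hw'⟩ := S'.exists_gf (θ u) (θ v)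
  rw [el_mul_el, twist_el, twist_el, twist_el, el_mul_el, map_mul, S.ga_eq_scale hk,
    S'.ga_eq_scale hk, hw, hw', map_mul, scale_embC2, mul_assoc a, mul_assoc a,
    ← mul_assoc _ _ (embC2 k w'), ← mul_assoc (embC2 k (r u)), embC2_mul_eq, scale_scale,
    ← Units.val_mul]
  have e : sign k (r u) * S'.scal hk (θ u) = S.scal hk u := by
    rw [h, ← mul_assoc, sign_mul_self, one_mul]
  rw [e]
  simp only [mul_assoc, ← embC2_mul]
  congr 4
  refine sign_injective hk ?_
  simp only [map_mul]
  rw [eq_mul_inv_of_mul_eq (S.scal_mul_scal hk hw).symm,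
    eq_mul_inv_of_mul_eq (S'.scal_mul_scal hk hw').symm, ← sign_inv (r u), ← sign_inv (r v),
    ← sign_inv (r (u * v)), hs, hs, hs, map_mul]
  ext
  push_cast
  field_simp

omit h in
theorem counit_twist (z : CrossedProduct S) :
    counit (R := k) (twist S S' r θ z) = counit (R := k) z := by
  have : counit ∘ₗ twist S S' r θ = counit (R := k) := hom_ext fun a u => by
    rw [LinearMap.comp_apply, twist_el, counit_el, counit_el, Bialgebra.counit_mul,
      (isGroupLikeElem_embC2 _).counit_eq_one, mul_one]
  exact LinearMap.congr_fun this z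

omit h in
theorem map_twist_comul (z : CrossedProduct S) :
    TensorProduct.map (twist S S' r θ) (twist S S' r θ) (comul z) =
      comul (R := k) (twist S S' r θ z) := by
  have : TensorProduct.map (twist S S' r θ) (twist S S' r θ) ∘ₗ comul =
      comul (R := k) ∘ₗ twist S S' r θ := hom_ext fun a u => by
    rw [LinearMap.comp_apply, LinearMap.comp_apply, twist_el, comul_el, comul_el,
      Bialgebra.comul_mul, (isGroupLikeElem_embC2 _).comul_eq_tmul_self]
    induction comul (R := k) a using TensorProduct.induction_on with
    | zero => simp
    | tmul b c => simp [diag_tmul]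
    | add y z hy hz => simp only [map_add, add_mul, hy, hz]
  exact LinearMap.congr_fun this z

/-- A group automorphism that carries the scalars of `S` to those of `S'` up to the signs of
`r : G → {1, g}` induces the isomorphism `a # u ↦ a r(u) # θ(u)`. -/
def bialgEquivOfMulEquiv : CrossedProduct S ≃ₐc[k] CrossedProduct S' :=
  .ofBijective
    (.ofAlgHom (.ofLinearMap (twist S S' r θ) (twist_one hk h) (twist_mul hk h))
      (AlgHom.toLinearMap_injective (LinearMap.ext counit_twist))
      (AlgHom.toLinearMap_injective (LinearMap.ext map_twist_comul)))
    (Function.bijective_iff_has_inverse.2 ⟨twist S' S (r ∘ θ.symm) θ.symm,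
      twist_twist _ _ _ _ (by simp) (by simp), twist_twist _ _ _ _ (by simp) (by simp)⟩)

end Twist

theorem nonempty_bialgEquiv_iff (hk : ringChar k ≠ 2) :
    Nonempty (CrossedProduct S ≃ₐc[k] CrossedProduct S') ↔
      ∃ θ : G ≃* G, ∀ u, ∃ w, S'.scal hk (θ u) = sign k w * S.scal hk u := by
  refine ⟨fun ⟨ψ⟩ => exists_mulEquiv_of_bialgEquiv hk ψ, fun ⟨θ, h⟩ => ?_⟩
  choose r hr using h
  exact ⟨bialgEquivOfMulEquiv hk hr⟩

end CrossedProduct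

/-! ### The parameters `(t, λ)` and their scalars -/

section Cyclic

variable {n : ℕ}

theorem gen_pow_eq_one : gen n ^ n = 1 := by
  rw [gen, ← ofAdd_nsmul]
  simp

theorem toAdd_gen_pow (j : ℕ) : Multiplicative.toAdd (gen n ^ j) = (j : ZMod n) := by
  simp [gen]

theorem gen_pow_val [NeZero n] (u : Cyc n) : gen n ^ (Multiplicative.toAdd u).val = u := by
  apply Multiplicative.toAdd.injective
  rw [toAdd_gen_pow, ZMod.natCast_zmod_val]

theorem exists_gen_pow [NeZero n] (u : Cyc n) : ∃ j ∈ Finset.Icc 1 n, u = gen n ^ j := by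
  by_cases h : (Multiplicative.toAdd u).val = 0
  · refine ⟨n, by simp [NeZero.one_le], ?_⟩
    rw [gen_pow_eq_one, ← gen_pow_val u, h, pow_zero]
  · refine ⟨_, ?_, (gen_pow_val u).symm⟩
    have := ZMod.val_lt (Multiplicative.toAdd u)
    simp only [Finset.mem_Icc]
    omega

theorem orderOf_gen : orderOf (gen n) = n := by
  rw [gen, orderOf_ofAdd_eq_addOrderOf, ZMod.addOrderOf_one]

theorem exists_mulEquiv_gen_pow [NeZero n] {s : ℕ} (hs : Nat.gcd s n = 1) :
    ∃ θ : Cyc n ≃* Cyc n, ∀ u, θ u = u ^ s := by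
  have hc : (Nat.card (Cyc n)).Coprime s := by
    have : Nat.card (Cyc n) = n := (Nat.card_congr Multiplicative.toAdd).trans (Nat.card_zmod n)
    rw [this]
    exact (Nat.coprime_comm.1 hs)
  exact ⟨MulEquiv.ofBijective (powMonoidHom s) (powCoprime hc).bijective, fun u => rfl⟩

theorem exists_forall_eq_pow [NeZero n] (θ : Cyc n ≃* Cyc n) :
    ∃ s ∈ Finset.Icc 1 n, Nat.gcd s n = 1 ∧ ∀ u, θ u = u ^ s := by
  obtain ⟨s, hs, h⟩ := exists_gen_pow (θ (gen n))
  refine ⟨s, hs, ?_, fun u => ?_⟩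
  · have ho : orderOf (gen n ^ s) = orderOf (gen n) := by rw [← h, MulEquiv.orderOf_eq]
    rw [orderOf_pow, orderOf_gen] at ho
    rw [Nat.gcd_comm]
    exact (Nat.div_eq_self.1 ho).resolve_left (NeZero.ne n)
  · rw [← gen_pow_val u, map_pow, h, pow_right_comm]

end Cyclic

section PartialProducts

variable {k : Type u} [Field k] {n : ℕ}

/-- The partial product `t(1) t(c) ⋯ t(c^(j-1))`. -/
def partialProd (t : UnitaryMap n) (j : ℕ) : Cyc 2 := ∏ p ∈ Finset.range j, t (gen n ^ p)

theorem partialProd_zero (t : UnitaryMap n) : partialProd t 0 = 1 := rfl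

theorem partialProd_succ (t : UnitaryMap n) (j : ℕ) :
    partialProd t (j + 1) = partialProd t j * t (gen n ^ j) :=
  Finset.prod_range_succ _ _

theorem partialProd_one (t : UnitaryMap n) : partialProd t 1 = 1 := by
  rw [partialProd_succ, partialProd_zero, pow_zero, one_mul]
  exact t.2

theorem partialProd_add (t : UnitaryMap n) (i j : ℕ) : partialProd t (j + i) =
    partialProd t j * ∏ p ∈ Finset.range i, t (gen n ^ (p + j)) := by
  rw [partialProd, Finset.prod_range_add]
  simp only [add_comm j]
  rfl

theorem partialProd_add_self (t : UnitaryMap n) (j : ℕ) :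
    partialProd t (j + n) = partialProd t j * partialProd t n := by
  rw [add_comm, partialProd_add, mul_comm]
  simp only [pow_add, gen_pow_eq_one, mul_one]
  rfl

theorem prod_mul_shift (t : UnitaryMap n) (i j : ℕ) :
    ∏ p ∈ Finset.range i, t (gen n ^ p) * t (gen n ^ (p + j)) =
      partialProd t i * partialProd t j * partialProd t (i + j) := by
  rw [Finset.prod_mul_distrib, add_comm i j, partialProd_add, mul_assoc,
    ← mul_assoc _ _ (∏ _ ∈ _, _), cyc_two_mul_self, one_mul]
  rfl

theorem neg_one_pow_sigma (t : UnitaryMap n) (j : ℕ) :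
    (-1 : kˣ) ^ sigma t j = sign k (partialProd t j) := by
  induction j with
  | zero => simp [sigma, partialProd_zero]
  | succ j ih =>
    rcases j with - | j
    · simp [sigma, partialProd_one]
    rw [partialProd_succ, map_mul, ← ih]
    rcases j with - | j
    · simp [sigma, neg_one_pow_orderOf, pow_add]
    have e : sigma t (j + 1 + 1 + 1) = (if Even (j + 1 + 1 + 1) then 1 else 0) +
        (∑ p ∈ Finset.Ico 1 (j + 1 + 1), orderOf (t (gen n ^ p)) +
          orderOf (t (gen n ^ (j + 1 + 1)))) := by
      rw [sigma, if_neg (by omega), Finset.sum_Ico_succ_top (by omega)]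
    have e' : sigma t (j + 1 + 1) = (if Even (j + 1 + 1) then 1 else 0) +
        ∑ p ∈ Finset.Ico 1 (j + 1 + 1), orderOf (t (gen n ^ p)) := by
      rw [sigma, if_neg (by omega)]
    rw [e, e', pow_add, pow_add, pow_add, neg_one_pow_orderOf]
    by_cases h : Even (j + 1 + 1)
    · rw [if_pos h, if_neg (by rw [Nat.even_add_one]; exact not_not_intro h)]
      simp [pow_add]
    · rw [if_neg h, if_pos (by rwa [Nat.even_add_one])]
      simp

end PartialProducts

namespace CS

variable {k : Type u} [Field k] {n : ℕ} (P : CS n k)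

/-- The scalar `(-1) ^ σ_t(j) λ ^ j` by which `c ^ j` acts on `x` in the crossed system given
by `(t, λ)`. -/
def coeff (j : ℕ) : kˣ := sign k (partialProd P.t j) * P.lam ^ j

theorem lam_pow_eq : P.lam ^ n = sign k (partialProd P.t n) :=
  P.lam_pow.trans (neg_one_pow_sigma _ _)

theorem coeff_periodic : Function.Periodic P.coeff n := fun j => by
  rw [coeff, partialProd_add_self, pow_add, lam_pow_eq, map_mul, coeff]
  rw [mul_mul_mul_comm, sign_mul_self, mul_one]

theorem coeff_mul_coeff (i j : ℕ) : P.coeff i * P.coeff j =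
    sign k (partialProd P.t i * partialProd P.t j * partialProd P.t (i + j)) *
      P.coeff (i + j) := by
  simp only [coeff, map_mul, pow_add]
  rw [mul_assoc _ (sign k (partialProd P.t (i + j))),
    ← mul_assoc (sign k (partialProd P.t (i + j))), sign_mul_self, one_mul, mul_mul_mul_comm]

/-- The scalar by which a group element acts on `x` in the crossed system given by `(t, λ)`. -/
def scalar (u : Cyc n) : kˣ := P.coeff (Multiplicative.toAdd u).val

theorem scalar_gen_pow (j : ℕ) : P.scalar (gen n ^ j) = P.coeff j := by
  rw [scalar, toAdd_gen_pow, ZMod.val_natCast, P.coeff_periodic.map_mod_nat]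

theorem scalar_one : P.scalar 1 = 1 := by
  rw [← pow_zero (gen n), scalar_gen_pow, coeff, partialProd_zero]
  simp

theorem isSignMul_scalar [NeZero n] : IsSignMul P.scalar := by
  refine ⟨P.scalar_one, fun u v => ?_⟩
  obtain ⟨i, -, rfl⟩ := exists_gen_pow u
  obtain ⟨j, -, rfl⟩ := exists_gen_pow v
  rw [← pow_add, scalar_gen_pow, scalar_gen_pow, scalar_gen_pow]
  exact ⟨_, P.coeff_mul_coeff i j⟩

theorem exists_scalar_eq [NeZero n] (hk : ringChar k ≠ 2) {α : Cyc n → kˣ} (hα : IsSignMul α) :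
    ∃ P : CS n k, P.scalar = α := by
  obtain ⟨h1, hm⟩ := hα
  have hT (j : ℕ) : ∃ w, α (gen n ^ j) = sign k w * α (gen n) ^ j := by
    induction j with
    | zero => exact ⟨1, by simp [h1]⟩
    | succ j ih =>
      obtain ⟨w, hw⟩ := ih
      obtain ⟨w', hw'⟩ := hm (gen n ^ j) (gen n)
      rw [← pow_succ, hw, mul_assoc, ← pow_succ] at hw'
      refine ⟨w' * w, ?_⟩
      rw [map_mul, mul_assoc, hw', ← mul_assoc, sign_mul_self, one_mul]
  choose T hT using hT
  have hT0 : T 0 = 1 := sign_injective hk (by simpa [h1] using (hT 0).symm)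
  have hT1 : T 1 = 1 := sign_injective hk (by simpa using (hT 1).symm)
  -- The quotients `T (j + 1) / T j` define the map with partial products `T`.
  let t : UnitaryMap n :=
    ⟨fun u => T (Multiplicative.toAdd u).val * T ((Multiplicative.toAdd u).val + 1),
      by simp [hT0, hT1]⟩
  have ht (j : ℕ) (hj : j ≤ n) : partialProd t j = T j := by
    induction j with
    | zero => rw [partialProd_zero, hT0]
    | succ j ih =>
      rw [partialProd_succ, ih (by omega)]
      change T j * (T (Multiplicative.toAdd (gen n ^ j)).val *
        T ((Multiplicative.toAdd (gen n ^ j)).val + 1)) = _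
      rw [toAdd_gen_pow, ZMod.val_natCast, Nat.mod_eq_of_lt (by omega), ← mul_assoc,
        cyc_two_mul_self, one_mul]
  refine ⟨⟨t, α (gen n), ?_⟩, funext fun u => ?_⟩
  · have h := hT n
    rw [gen_pow_eq_one, h1] at h
    rw [neg_one_pow_sigma, ht n le_rfl, ← sign_inv]
    exact (inv_eq_of_mul_eq_one_right h.symm).symm
  · obtain ⟨j, hj, rfl⟩ := exists_gen_pow u
    rw [scalar_gen_pow, coeff, ht j (Finset.mem_Icc.1 hj).2, ← hT]

theorem neg_one_pow_mul_lam_pow (w : Cyc 2) (i : ℕ) :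
    (-1) ^ (1 + sigma P.t i + orderOf w) * P.lam ^ i = sign k w * P.coeff i := by
  rw [pow_add, pow_add, neg_one_pow_orderOf, neg_one_pow_sigma, coeff]
  simp [mul_comm, mul_left_comm]

theorem neg_one_pow_sigma_mul_lam_pow (i : ℕ) :
    (-1) ^ sigma P.t i * P.lam ^ i = P.coeff i := by
  rw [neg_one_pow_sigma, coeff]

variable {P} {P' : CS n k}

/-- The condition on cocycles follows from the condition on scalars, as the scalars determine the
cocycle. -/
theorem prod_eq_of_coeff (hk : ringChar k ≠ 2) {r : UnitaryMap n} {s : ℕ}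
    (h : ∀ i, P'.coeff (i * s) = sign k (r (gen n ^ i)) * P.coeff i) (i j : ℕ) :
    ∏ p ∈ Finset.range i, P.t (gen n ^ p) * P.t (gen n ^ (p + j)) =
      r (gen n ^ i) * r (gen n ^ j) * r (gen n ^ (i + j)) *
        ∏ q ∈ Finset.range (i * s), P'.t (gen n ^ q) * P'.t (gen n ^ (q + j * s)) := by
  have hs (i : ℕ) : sign k (r (gen n ^ i)) = P'.coeff (i * s) * (P.coeff i)⁻¹ := by simp [h]
  rw [prod_mul_shift, prod_mul_shift]
  refine sign_injective hk ?_
  rw [eq_mul_inv_of_mul_eq (P.coeff_mul_coeff i j).symm, map_mul,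
    eq_mul_inv_of_mul_eq (P'.coeff_mul_coeff (i * s) (j * s)).symm, map_mul, map_mul,
    ← sign_inv (r (gen n ^ i)), ← sign_inv (r (gen n ^ j)), hs, hs, hs, ← add_mul]
  ext
  push_cast
  field_simp

theorem exists_unitaryMap (hk : ringChar k ≠ 2) {θ : Cyc n ≃* Cyc n}
    (h : ∀ u, ∃ w, P'.scalar (θ u) = sign k w * P.scalar u) :
    ∃ r : UnitaryMap n, ∀ u, P'.scalar (θ u) = sign k (r u) * P.scalar u := by
  choose r hr using h
  refine ⟨⟨r, sign_injective hk ?_⟩, hr⟩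
  simpa [scalar_one] using (hr 1).symm

theorem approx_iff [NeZero n] (hk : ringChar k ≠ 2) :
    Approx P P' ↔ ∀ u, ∃ w, P'.scalar u = sign k w * P.scalar u := by
  constructor
  · rintro ⟨r, -, h⟩ u
    obtain ⟨i, hi, rfl⟩ := exists_gen_pow u
    have := h i hi
    rw [neg_one_pow_mul_lam_pow, neg_one_pow_sigma_mul_lam_pow] at this
    exact ⟨_, by rw [scalar_gen_pow, scalar_gen_pow, this]⟩
  · intro h
    obtain ⟨r, hr⟩ := exists_unitaryMap hk (θ := .refl _) h
    have hc (i : ℕ) : P'.coeff (i * 1) = sign k (r (gen n ^ i)) * P.coeff i := by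
      rw [mul_one, ← scalar_gen_pow, ← scalar_gen_pow]
      exact hr _
    refine ⟨r, fun i _ j _ => by simpa using prod_eq_of_coeff hk hc i j, fun i _ => ?_⟩
    rw [neg_one_pow_mul_lam_pow, neg_one_pow_sigma_mul_lam_pow, ← hc, mul_one]

theorem equi_iff [NeZero n] (hk : ringChar k ≠ 2) :
    Equi P P' ↔ ∃ θ : Cyc n ≃* Cyc n, ∀ u, ∃ w, P'.scalar (θ u) = sign k w * P.scalar u := by
  constructor
  · rintro ⟨β, r, s, hs, hsn, -, h⟩
    obtain ⟨θ, hθ⟩ := exists_mulEquiv_gen_pow hsn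
    refine ⟨θ, fun u => ?_⟩
    have h' (i : ℕ) (hi : i ∈ Finset.Icc 1 n) :
        sign k (r (gen n ^ i)) * P.scalar (gen n ^ i) * β = P'.scalar (θ (gen n ^ i)) := by
      rw [hθ, ← pow_mul, scalar_gen_pow, scalar_gen_pow, ← neg_one_pow_mul_lam_pow,
        ← neg_one_pow_sigma_mul_lam_pow]
      exact h i hi
    -- The exponent `i = n` forces `β = 1`.
    have hβ : β = 1 := by
      have := h' n (by simp [NeZero.one_le])
      rw [gen_pow_eq_one, map_one, scalar_one, scalar_one, show r 1 = 1 from r.2] at this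
      simpa using this
    obtain ⟨i, hi, rfl⟩ := exists_gen_pow u
    exact ⟨r (gen n ^ i), by rw [← h' i hi, hβ, mul_one]⟩
  · rintro ⟨θ, h⟩
    obtain ⟨r, hr⟩ := exists_unitaryMap hk h
    obtain ⟨s, hs, hsn, hθ⟩ := exists_forall_eq_pow θ
    have hc (i : ℕ) : P'.coeff (i * s) = sign k (r (gen n ^ i)) * P.coeff i := by
      rw [← scalar_gen_pow, ← scalar_gen_pow, pow_mul, ← hθ]
      exact hr _
    refine ⟨1, r, s, hs, hsn, fun i _ j _ => prod_eq_of_coeff hk hc i j, fun i _ => ?_⟩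
    rw [neg_one_pow_mul_lam_pow, neg_one_pow_sigma_mul_lam_pow, ← hc, mul_one]

end CS

/-! ### The classification -/

section Classification

open SweedlerH4

variable {k : Type u} [Field k] {n : ℕ}

theorem CrossedSystem.isGivenBy_of_scal_eq (hk : ringChar k ≠ 2)
    {S : CrossedSystem k (SweedlerH4 k) (MonoidAlgebra k (Cyc n))} {P : CS n k}
    (h : S.scal hk = P.scalar) : S.IsGivenBy P := by
  have hx (j : ℕ) : S.ga (gen n ^ j) (x k) = ((-1) ^ sigma P.t j * (P.lam : k) ^ j) • x k := by
    rw [S.ga_x hk, h, P.scalar_gen_pow, ← P.neg_one_pow_sigma_mul_lam_pow]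
    push_cast
    rfl
  refine ⟨fun j _ => ⟨S.ga_one _, S.ga_g _, hx j, ?_⟩, fun i _ j _ => S.gf_eq_of_scal hk ?_⟩
  · refine (S.ga_mul _ _ _).trans ?_
    rw [S.ga_g, hx, mul_smul_comm]
  · rw [h, ← pow_add, P.scalar_gen_pow, P.scalar_gen_pow, P.scalar_gen_pow]
    exact P.coeff_mul_coeff i j

/-- A map `F` that reflects and preserves the relations and meets every class of the target induces
a bijection of the quotients. -/
theorem exists_quot_equiv {X : Type u} {Y : Type v} {r : X → X → Prop} {s : Y → Y → Prop}
    (hs : Equivalence s) (F : X → Y) (hF : ∀ x x', r x x' ↔ s (F x) (F x'))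
    (hsurj : ∀ y, ∃ x, s (F x) y) :
    Equivalence r ∧ ∃ Φ : Quot s ≃ Quot r, ∀ x, Φ (Quot.mk s (F x)) = Quot.mk r x := by
  have hr : Equivalence r :=
    ⟨fun x => (hF x x).2 (hs.refl _), fun h => (hF _ _).2 (hs.symm ((hF _ _).1 h)),
      fun h h' => (hF _ _).2 (hs.trans ((hF _ _).1 h) ((hF _ _).1 h'))⟩
  have hbij : Function.Bijective (Quot.map F fun x x' => (hF x x').1) := by
    constructor
    · rintro ⟨x⟩ ⟨x'⟩ h
      exact Quot.sound ((hF x x').2 (hs.quot_mk_eq_iff _ _ |>.1 h))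
    · rintro ⟨y⟩
      obtain ⟨x, hx⟩ := hsurj y
      exact ⟨Quot.mk r x, Quot.sound hx⟩
  exact ⟨hr, (Equiv.ofBijective _ hbij).symm, fun x =>
    (Equiv.symm_apply_eq _).2 rfl⟩

variable [NeZero n]

/-- Both parts of the classification: an equivalence relation on crossed systems that depends only
on the scalars corresponds to a relation on the pairs `(t, λ)`. -/
theorem exists_quot_equiv_of_scal (hk : ringChar k ≠ 2)
    {r : CS n k → CS n k → Prop}
    {s : CrossedSystem k (SweedlerH4 k) (MonoidAlgebra k (Cyc n)) →
      CrossedSystem k (SweedlerH4 k) (MonoidAlgebra k (Cyc n)) → Prop}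
    (hs : Equivalence s) (hscal : ∀ S S', S.scal hk = S'.scal hk → s S S')
    (hrs : ∀ S S' P P', S.scal hk = P.scalar → S'.scal hk = P'.scalar → (r P P' ↔ s S S')) :
    Equivalence r ∧ ∃ Φ : Quot s ≃ Quot r,
      ∀ P, ∃ S, S.IsGivenBy P ∧ Φ (Quot.mk s S) = Quot.mk r P := by
  choose F hF using fun P : CS n k => CrossedSystem.exists_scal_eq hk P.isSignMul_scalar
  obtain ⟨hr, Φ, hΦ⟩ := exists_quot_equiv hs F (fun P P' => hrs _ _ P P' (hF P) (hF P'))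
    fun S => (CS.exists_scalar_eq hk (S.isSignMul_scal hk)).imp fun P hP =>
      hscal _ _ ((hF P).trans hP)
  exact ⟨hr, Φ, fun P => ⟨F P, CrossedSystem.isGivenBy_of_scal_eq hk (hF P), hΦ P⟩⟩

end Classification

end

end HopfCrossed

theorem theorem3p5 {k : Type u} [Field k] (hk : ringChar k ≠ 2) (n : ℕ) (hn : 0 < n) :
    (Equivalence (HopfCrossed.CrossedSystem.Cohomologous (k := k) (A := HopfCrossed.SweedlerH4 k)
        (H := MonoidAlgebra k (HopfCrossed.Cyc n))) ∧
      Equivalence (HopfCrossed.CS.Approx (n := n) (k := k)) ∧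
      ∃ Φ : HopfCrossed.H2 k (HopfCrossed.SweedlerH4 k) (MonoidAlgebra k (HopfCrossed.Cyc n)) ≃
          Quot (HopfCrossed.CS.Approx (n := n) (k := k)),
        ∀ P : HopfCrossed.CS n k,
          ∃ S : HopfCrossed.CrossedSystem k (HopfCrossed.SweedlerH4 k)
              (MonoidAlgebra k (HopfCrossed.Cyc n)),
            S.IsGivenBy P ∧ Φ (Quot.mk _ S) = Quot.mk _ P) ∧
    (Equivalence (HopfCrossed.CS.Equi (n := n) (k := k)) ∧
      ∃ Ψ : HopfCrossed.Crp k (HopfCrossed.SweedlerH4 k) (HopfCrossed.Cyc n) ≃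
          Quot (HopfCrossed.CS.Equi (n := n) (k := k)),
        ∀ P : HopfCrossed.CS n k,
          ∃ S : HopfCrossed.CrossedSystem k (HopfCrossed.SweedlerH4 k)
              (MonoidAlgebra k (HopfCrossed.Cyc n)),
            S.IsGivenBy P ∧
              Ψ (Quotient.mk (HopfCrossed.crossedProductIso k _ _) S) = Quot.mk _ P) := by
  have : NeZero n := ⟨hn.ne'⟩
  have hcoh := HopfCrossed.CrossedSystem.equivalence_cohomologous (k := k)
    (G := HopfCrossed.Cyc n) hk
  refine ⟨⟨hcoh, HopfCrossed.exists_quot_equiv_of_scal hk hcoh (fun S S' h => ?_)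
    fun S S' P P' hS hS' => ?_⟩, HopfCrossed.exists_quot_equiv_of_scal hk
      (HopfCrossed.crossedProductIso k _ _).iseqv (fun S S' h => ?_) fun S S' P P' hS hS' => ?_⟩
  · exact (HopfCrossed.CrossedSystem.cohomologous_iff_scal hk S S').2 fun u =>
      ⟨1, by rw [h, map_one, one_mul]⟩
  · rw [HopfCrossed.CS.approx_iff hk, HopfCrossed.CrossedSystem.cohomologous_iff_scal hk, hS, hS']
  · exact (HopfCrossed.CrossedProduct.nonempty_bialgEquiv_iff hk).2
      ⟨.refl _, fun u => ⟨1, by rw [h, map_one, one_mul]; rfl⟩⟩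
  · rw [HopfCrossed.CS.equi_iff hk, ← hS, ← hS']
    exact (HopfCrossed.CrossedProduct.nonempty_bialgEquiv_iff hk).symm
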